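/- Consider a piston of mass $M$ moving on the line $\mathbb R$ in an ideal gas of atoms of mass $m$, and put $\varepsilon=m/M$. Fix $0<v_{\min}<v_{\max}<\infty$, spatial densities $n_-,n_+>0$, and even probability densities $f_-,f_+$ on $\mathbb R$ that vanish at all $v$ with $|v|\le v_{\min}$ or $|v|\ge v_{\max}$ and satisfy the pressure balance $$n_-\int_0^\infty v^2f_-(v)\,dv=n_+\int_0^\infty v^2f_+(v)\,dv .$$ The initial positions and velocities $(x,v)$ of the atoms form a Poisson process on $\mathbb R^2$ with density $p(x,v)=n_+f_+(v)$ for $x>0$ and $p(x,v)=n_-f_-(v)$ for $x<0$. The piston starts at the origin with velocity $V(0)$, where $|V(0)|<\varepsilon^{1/2}$. The atoms do not interact with each other; between collisions with the piston, the atoms and the piston move with constant velocities, and when an atom of velocity $v$ meets the piston of velocity $V$, their velocities change to $$V'=\frac{M-m}{M+m}V+\frac{2m}{M+m}v,\qquad v'=-\frac{M-m}{M+m}v+\frac{2M}{M+m}V .$$ Let $V(t)$ be the velocity of the piston in this dynamics. For a cutoff value $\bar V$ with $0<\bar V<V_{\max}=\frac{M-m}{3M+m}v_{\min}$, let $W(t)$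 (the Markov approximation, with the same initial configuration of the atoms and $W(0)=V(0)$) be the velocity of the piston in the dynamics in which the velocity $V'$ of the piston after a collision is replaced by $2\bar V-V'$ if $V'>\bar V$ and by $-2\bar V-V'$ if $V'<-\bar V$. Then there is a constant $d>0$, which depends only on $n_\pm,f_\pm,v_{\min},v_{\max}$, such that for every $\bar V>0$ there is $\varepsilon_0>0$ such that for all $m,M>0$ with $\varepsilon=m/M<\varepsilon_0$ and $\bar V<V_{\max}$, all $V(0)$ with $|V(0)|<\varepsilon^{1/2}$ and all $T>0$, $$P\Big(V(t)=W(t)\ \ \forall t\in(0,T)\Big)\ \ge\ 1-T^2\,\varepsilon^{\,d\ln\ln \varepsilon^{-1}} .$$ Here the event includes that both dynamics are well defined on $(0,T)$ (finitely many collisions before each time $t<T$, no two of them simultaneous), and the bound means that some measurable subset of the event has at least this probability. -/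

import Mathlib

open MeasureTheory ProbabilityTheory Set
open scoped ENNReal NNReal

namespace Piston

/-! ### The gas -/

/-- `f` is a symmetric probability density on the line that satisfies the velocity cutoff:
it vanishes at all velocities `v` with `|v| ≤ vmin` or `|v| ≥ vmax`. -/
structure IsCutoffDensity (vmin vmax : ℝ) (f : ℝ → ℝ) : Prop where
  measurable : Measurable f
  nonneg : ∀ v, 0 ≤ f v
  integrable : Integrable f volume
  integral_eq_one : ∫ v, f v = 1
  symm : ∀ v, f (-v) = f v
  cutoff : ∀ v, |v| ≤ vmin ∨ vmax ≤ |v| → f v = 0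

/-- Pressure balance (mechanical equilibrium) between the left gas, with spatial density `nL` and
velocity density `fL`, and the right gas, with `nR` and `fR`. -/
def PressureBalance (nL nR : ℝ) (fL fR : ℝ → ℝ) : Prop :=
  nL * ∫ v in Ioi (0 : ℝ), v ^ 2 * fL v = nR * ∫ v in Ioi (0 : ℝ), v ^ 2 * fR v

/-- The density `p(x, v)` of the initial gas: `nR * fR v` to the right of the origin,
`nL * fL v` to the left of it. -/
noncomputable def gasDensity (nL nR : ℝ) (fL fR : ℝ → ℝ) (z : ℝ × ℝ) : ℝ :=
  if 0 < z.1 then nR * fR z.2 else if z.1 < 0 then nL * fL z.2 else 0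

/-- The measure `p(x, v) dx dv` on the plane of positions and velocities. -/
noncomputable def gasIntensity (nL nR : ℝ) (fL fR : ℝ → ℝ) : Measure (ℝ × ℝ) :=
  volume.withDensity fun z => ENNReal.ofReal (gasDensity nL nR fL fR z)

/-- The random set of points `S` is a Poisson process with intensity measure `Λ` (a measure
without atoms, so that all points are simple): the number of points in a measurable set `D` of
finite intensity has the Poisson distribution with parameter `Λ D`, and the numbers of points in
pairwise disjoint sets are independent. -/
structure IsPoissonProcess {Ω E : Type*} [MeasurableSpace Ω] [MeasurableSpace E]
    (μ : Measure Ω) (Λ : Measure E) (S : Ω → Set E) : Prop where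
  measurable_count : ∀ D : Set E, MeasurableSet D → Measurable fun ω => (S ω ∩ D).encard
  map_count : ∀ D : Set E, MeasurableSet D → Λ D ≠ ∞ →
    μ.map (fun ω => (S ω ∩ D).encard)
      = (poissonMeasure (Λ D).toNNReal).map (fun k : ℕ => (k : ℕ∞))
  indep_count : ∀ (k : ℕ) (D : Fin k → Set E), (∀ i, MeasurableSet (D i)) →
    Pairwise (fun i j => Disjoint (D i) (D j)) →
    iIndepFun (fun i ω => (S ω ∩ D i).encard) μ

/-! ### The dynamics of the piston -/

/-- A state of the system piston + gas, at the time `time`: the position and the velocity of the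
piston, and the set of the atoms, each given by its current position and velocity. -/
structure State where
  time : ℝ
  pos : ℝ
  vel : ℝ
  atoms : Set (ℝ × ℝ)

/-- The velocity of the piston after the elastic collision of the piston (mass `M`, velocity `V`)
with an atom (mass `m`, velocity `v`). -/
noncomputable def pistonAfter (m M V v : ℝ) : ℝ :=
  (M - m) / (M + m) * V + 2 * m / (M + m) * v

/-- The velocity of the atom after that collision. -/
noncomputable def atomAfter (m M V v : ℝ) : ℝ :=
  -((M - m) / (M + m)) * v + 2 * M / (M + m) * V

/-- Reflection of a velocity at `b` and `-b`. -/
noncomputable def reflectAt (b w : ℝ) : ℝ :=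
  if b < w then 2 * b - w else if w < -b then -2 * b - w else w

/-- In free motion started from the state `s`, the atom `a` and the piston, which are at different
places in the state `s`, meet after the time `τ > 0`. (An atom that has just collided is at the
place of the piston and has another velocity, so that it does not meet it again before
the velocity of the piston changes.) -/
def Meets (s : State) (a : ℝ × ℝ) (τ : ℝ) : Prop :=
  0 < τ ∧ a.1 ≠ s.pos ∧ a.1 + a.2 * τ = s.pos + s.vel * τ

/-- The first collision after the state `s` takes place after the time `τ`, with the atom `a`
and with no other atom. -/
def IsNextCollision (s : State) (a : ℝ × ℝ) (τ : ℝ) : Prop :=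
  a ∈ s.atoms ∧ Meets s a τ ∧ ∀ b ∈ s.atoms, b ≠ a → ∀ σ ≤ τ, ¬ Meets s b σ

/-- The state right after the collision with the atom `a` that takes place after the time `τ`.
All atoms and the piston move freely for the time `τ`; then the atom `a` gets the velocity
`atomAfter`, and the piston the velocity `rule (pistonAfter ..)`. Elastic collisions are
`rule = id`. -/
noncomputable def State.collide (m M : ℝ) (rule : ℝ → ℝ) (s : State) (a : ℝ × ℝ) (τ : ℝ) :
    State where
  time := s.time + τ
  pos := s.pos + s.vel * τ
  vel := rule (pistonAfter m M s.vel a.2)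
  atoms := insert (s.pos + s.vel * τ, atomAfter m M s.vel a.2)
    ((fun b : ℝ × ℝ => (b.1 + b.2 * τ, b.2)) '' (s.atoms \ {a}))

/-- `s'` is the state right after the first collision that follows the state `s`. -/
def Step (m M : ℝ) (rule : ℝ → ℝ) (s s' : State) : Prop :=
  ∃ a τ, IsNextCollision s a τ ∧ s' = s.collide m M rule a τ

/-- The state at time `0`: the piston is at the origin with velocity `V₀`. -/
def initState (V₀ : ℝ) (A : Set (ℝ × ℝ)) : State where
  time := 0
  pos := 0
  vel := V₀
  atoms := A

/-- With the collision rule `rule`, initial velocity `V₀` of the piston and initial configuration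
`A` of the atoms, the dynamics is defined up to and including the time `t`, and the velocity of the
piston at the time `t` is `v`: finitely many collisions lead to a state with piston velocity `v`
from which no further collision occurs up to the time `t`. -/
def HasVelocityAt (m M : ℝ) (rule : ℝ → ℝ) (V₀ : ℝ) (A : Set (ℝ × ℝ)) (t v : ℝ) : Prop :=
  ∃ s, Relation.ReflTransGen (Step m M rule) (initState V₀ A) s ∧ s.time ≤ t ∧
    (∀ a ∈ s.atoms, ∀ τ, Meets s a τ → t < s.time + τ) ∧ s.vel = v

/-- `V(t) = v`: the true velocity of the piston, whose collisions with the atoms are elastic. -/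
def TrueVelocity (m M V₀ : ℝ) (A : Set (ℝ × ℝ)) (t v : ℝ) : Prop :=
  HasVelocityAt m M id V₀ A t v

/-- `W(t) = w`: the Markov approximation, in which the velocity of the piston after a collision is
reflected at `b` and `-b`. -/
def MarkovVelocity (m M b V₀ : ℝ) (A : Set (ℝ × ℝ)) (t w : ℝ) : Prop :=
  HasVelocityAt m M (reflectAt b) V₀ A t w

/-- A piston that is slower than this bound collides with every atom at most once. -/
noncomputable def maxSpeed (m M vmin : ℝ) : ℝ := (M - m) / (3 * M + m) * vmin

/-- For the initial configuration `A` of the atoms, both velocities are defined on `(0, T)`, and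
they coincide there. -/
def VelocitiesCoincide (m M b V₀ : ℝ) (A : Set (ℝ × ℝ)) (T : ℝ) : Prop :=
  ∀ t ∈ Ioo 0 T, ∃ v, TrueVelocity m M V₀ A t v ∧ MarkovVelocity m M b V₀ A t v

/-! ### The velocity is well defined -/

theorem Meets.unique {s : State} {a : ℝ × ℝ} {τ σ : ℝ} (h : Meets s a τ) (h' : Meets s a σ) :
    τ = σ := by
  obtain ⟨-, h2, h3⟩ := h
  obtain ⟨-, -, h6⟩ := h'
  have h7 : (a.2 - s.vel) * (τ - σ) = 0 := by linear_combination h3 - h6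
  rcases mul_eq_zero.mp h7 with h8 | h8
  · exact absurd (by linear_combination h3 - τ * h8) h2
  · linarith

theorem step_rightUnique (m M : ℝ) (rule : ℝ → ℝ) : Relator.RightUnique (Step m M rule) := by
  rintro s _ _ ⟨a, τ, ⟨ha, hm, hn⟩, rfl⟩ ⟨b, σ, ⟨hb, hm', hn'⟩, rfl⟩
  have hab : a = b := by
    by_contra hne
    rcases le_total τ σ with h | h
    · exact hn' a ha hne τ h hm
    · exact hn b hb (Ne.symm hne) σ h hm'
  subst hab
  rw [hm.unique hm']

theorem time_le_of_reaches {m M : ℝ} {rule : ℝ → ℝ} {s s' : State}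
    (h : Relation.ReflTransGen (Step m M rule) s s') : s.time ≤ s'.time := by
  induction h with
  | refl => exact le_rfl
  | tail _ h ih =>
    obtain ⟨a, τ, ⟨-, ⟨hτ, -⟩, -⟩, rfl⟩ := h
    exact ih.trans (le_add_of_nonneg_right hτ.le)

/-- At every time there is at most one velocity of the piston. -/
theorem HasVelocityAt.unique {m M : ℝ} {rule : ℝ → ℝ} {V₀ : ℝ} {A : Set (ℝ × ℝ)} {t v w : ℝ}
    (h : HasVelocityAt m M rule V₀ A t v) (h' : HasVelocityAt m M rule V₀ A t w) : v = w := by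
  have key : ∀ s s' : State, Relation.ReflTransGen (Step m M rule) s s' →
      (∀ a ∈ s.atoms, ∀ τ, Meets s a τ → t < s.time + τ) → s'.time ≤ t → s = s' := by
    intro s s' hr hs ht
    rcases hr.cases_head with h | ⟨c, ⟨a, τ, ⟨ha, hm, -⟩, rfl⟩, hc⟩
    · exact h
    · have h1 := time_le_of_reaches hc
      have h2 := hs a ha τ hm
      simp only [State.collide] at h1
      linarith
  obtain ⟨s, hr, ht, hs, rfl⟩ := h
  obtain ⟨s', hr', ht', hs', rfl⟩ := h'
  rcases Relation.ReflTransGen.total_of_right_unique (step_rightUnique m M rule) hr hr' with h | h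
  · rw [key s s' h hs ht']
  · rw [key s' s h hs' ht]

end Piston

namespace Piston

/-! Both dynamics follow the same path until a collision takes the piston beyond speed `b`, so it
suffices that the elastic piston stays within `b`. Below `maxSpeed` an atom that has been hit leaves
faster than the piston can follow. Every collision is then with an atom that still moves on its
initial line, the motion of the piston is an explicit function of the list of atoms met
(`pistonLine`), and an atom has been met exactly when its line, continued as if there were no
piston, has crossed the path of the piston (`History`).

Drag keeps the piston slow. In a window of length `τ = κ / ε` the piston meets `O(1/ε)` atoms, each
changing its velocity by `O(ε)`; `κ` is chosen so that the total change is at most `b / 8`. If the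
speed is at least `b / 4` at the start of the window, it is at least `c = b / 8` throughout. Such a
piston is hit from behind by at most as many atoms as a wall at rest, and from the front by at least
as many; they contribute momenta proportional to `|v| - c` and `|v| + c`. In the mean the quadratic
terms cancel by pressure balance, and a drag proportional to `c τ` remains. It dominates the
discretization errors and fluctuations of order `η τ` in the counts, so the velocity does not grow
(`bin_balance`, `Window.slow_down`). By induction over the windows the speed is at most `b / 2` at
all their ends (`exists_historyAt_of_counts`).

The position of the piston is random and depends on the gas. The counts are therefore controlled for
all cells of a grid of mesh `η τ` and for finitely many bins of speeds. Each count is Poisson with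
mean `O(1/ε)`, so by Chernoff's bound it is atypical with probability `exp(-const/ε)`. For `T ≥ 1`
there are `O(T)` windows with `O(T)` cells each, whence the factor `T ^ 2`
(`measure_not_coincide_le`). For `T ≤ 1` no drag is needed: a velocity change of `b / 2` takes of
order `1/ε` atoms out of a region of intensity `O(T)`, and the Poisson tail yields `T ^ 2` as well
(`measure_not_coincide_le_sq`). Since `exp(-const/ε)` is smaller than `ε ^ (d * log log ε⁻¹)` for
any fixed `d`, the choice `d = 1` works.

Almost surely no two collisions are simultaneous, because given the other atoms a tie confines one
atom to a line in the plane (`IsPoissonProcess.ae_generic`). -/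

/-! ### Collision by collision description of a slow piston -/

/-- The parameters for which a piston with speed at most `b` meets every atom at most once. -/
structure SlowRegime (m M b vmin : ℝ) : Prop where
  m_pos : 0 < m
  M_pos : 0 < M
  b_pos : 0 < b
  vmin_pos : 0 < vmin
  lt_maxSpeed : b < maxSpeed m M vmin

/-- The relative change of velocity of the piston in a collision. -/
noncomputable def kick (m M : ℝ) : ℝ := 2 * m / (M + m)

/-- This form says that even in the extreme case `V = -b`, `v = -vmin` the reflected atom has
velocity above `b`; it is the origin of the expression `maxSpeed`. -/
theorem SlowRegime.recede {m M b vmin : ℝ} (h : SlowRegime m M b vmin) :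
    b * (3 * M + m) < (M - m) * vmin := by
  have h1 := h.lt_maxSpeed
  have hM := h.M_pos
  have hm := h.m_pos
  unfold maxSpeed at h1
  rw [div_mul_eq_mul_div, lt_div_iff₀ (by positivity)] at h1
  exact h1

theorem SlowRegime.m_lt_M {m M b vmin : ℝ} (h : SlowRegime m M b vmin) : m < M := by
  have h1 := h.recede
  have hM := h.M_pos
  have hm := h.m_pos
  have h2 : 0 < b * (3 * M + m) := mul_pos h.b_pos (by positivity)
  by_contra hlt
  nlinarith [h.vmin_pos]

theorem SlowRegime.three_mul_lt {m M b vmin : ℝ} (h : SlowRegime m M b vmin) : 3 * b < vmin := by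
  have h1 := h.recede
  have hM := h.M_pos
  have hm := h.m_pos
  have hv := h.vmin_pos
  have hb := h.b_pos
  by_contra hlt
  push Not at hlt
  nlinarith [mul_pos hm hb, mul_pos hm hv, mul_le_mul_of_nonneg_right hlt hM.le]

theorem SlowRegime.b_lt_vmin {m M b vmin : ℝ} (h : SlowRegime m M b vmin) : b < vmin := by
  linarith [h.three_mul_lt, h.b_pos]

/-- A collision moves `V` towards `v` by the fraction `kick`. For fixed `v` the change is monotone
in `V`, so bounds for `V` in a window bound the sum of all changes. -/
theorem pistonAfter_eq {m M : ℝ} (h : 0 < M + m) (V v : ℝ) :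
    pistonAfter m M V v = V + kick m M * (v - V) := by
  unfold pistonAfter kick
  field_simp
  ring

theorem kick_pos {m M : ℝ} (hm : 0 < m) (hM : 0 < M) : 0 < kick m M := by
  unfold kick; positivity

theorem kick_le {m M : ℝ} (hm : 0 < m) (hM : 0 < M) : kick m M ≤ 2 * (m / M) := by
  unfold kick
  rw [mul_div_assoc]
  gcongr
  linarith

/-- An atom that comes from the right leaves a slow piston for good. -/
theorem SlowRegime.lt_atomAfter {m M b vmin V v : ℝ} (h : SlowRegime m M b vmin)
    (hV : |V| ≤ b) (hv : v < -vmin) : b < atomAfter m M V v := by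
  have h1 := h.recede
  have hM := h.M_pos
  have hm := h.m_pos
  have hlt := h.m_lt_M
  have hs : 0 < M + m := by positivity
  have e : atomAfter m M V v = (-(M - m) * v + 2 * M * V) / (M + m) := by
    unfold atomAfter; field_simp
  rw [e, lt_div_iff₀ hs]
  have hV' := neg_le_of_abs_le hV
  nlinarith [mul_le_mul_of_nonneg_left hV' hM.le]

theorem atomAfter_neg (m M V v : ℝ) : atomAfter m M (-V) (-v) = -atomAfter m M V v := by
  unfold atomAfter; ring

theorem SlowRegime.atomAfter_lt {m M b vmin V v : ℝ} (h : SlowRegime m M b vmin)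
    (hV : |V| ≤ b) (hv : vmin < v) : atomAfter m M V v < -b := by
  have := h.lt_atomAfter (V := -V) (v := -v) (by rwa [abs_neg]) (by linarith)
  rw [atomAfter_neg] at this
  linarith

/-- The time at which an atom `a` meets the piston that moves along the line `p.1 + p.2 * t`. -/
noncomputable def meetTime (p a : ℝ × ℝ) : ℝ := (p.1 - a.1) / (a.2 - p.2)

/-- The line `p.1 + p.2 * t` along which the piston moves after elastic collisions with the
atoms of a list, the last one first; the atoms are given by their initial data. -/
noncomputable def pistonLine (m M V₀ : ℝ) : List (ℝ × ℝ) → ℝ × ℝ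
  | [] => (0, V₀)
  | a :: l =>
    (a.1 + a.2 * meetTime (pistonLine m M V₀ l) a
        - pistonAfter m M (pistonLine m M V₀ l).2 a.2 * meetTime (pistonLine m M V₀ l) a,
      pistonAfter m M (pistonLine m M V₀ l).2 a.2)

/-- The configurations of the gas for which no two atoms meet the piston simultaneously and only
finitely many atoms are within reach. -/
structure RegularGas (m M V₀ vmin vmax : ℝ) (A : Set (ℝ × ℝ)) : Prop where
  ne_zero : ∀ a ∈ A, a.1 ≠ 0
  lt_speed : ∀ a ∈ A, vmin < |a.2|
  speed_lt : ∀ a ∈ A, |a.2| < vmax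
  finite : ∀ r : ℝ, (A ∩ {a | |a.1| ≤ r}).Finite
  generic : ∀ (l : List (ℝ × ℝ)) (a c : ℝ × ℝ), (c :: a :: l).Nodup →
    (∀ x ∈ c :: a :: l, x ∈ A) →
    c.1 + c.2 * meetTime (pistonLine m M V₀ l) a ≠ a.1 + a.2 * meetTime (pistonLine m M V₀ l) a

/-- The atom `p` moves away from any piston of speed at most `b`. -/
def Away (b : ℝ) (s : State) (p : ℝ × ℝ) : Prop :=
  (s.pos ≤ p.1 ∧ b < p.2) ∨ (p.1 ≤ s.pos ∧ p.2 < -b)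

/-- The state `s` arises from the initial configuration `A` by collisions with the atoms of the
list `l`, the last one first, and the piston is slow. -/
structure History (m M b V₀ : ℝ) (A : Set (ℝ × ℝ)) (s : State) (l : List (ℝ × ℝ)) : Prop where
  vel_eq : s.vel = (pistonLine m M V₀ l).2
  pos_eq : s.pos = (pistonLine m M V₀ l).1 + s.vel * s.time
  slow : |s.vel| ≤ b
  nodup : l.Nodup
  mem : ∀ a ∈ l, a ∈ A
  atoms : ∀ p ∈ s.atoms, (∃ a ∈ A, a ∉ l ∧ p = (a.1 + a.2 * s.time, a.2)) ∨ Away b s p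
  free : ∀ a ∈ A, a ∉ l → (a.1 + a.2 * s.time, a.2) ∈ s.atoms
  right : ∀ a ∈ A, a ∉ l → 0 < a.1 → s.pos < a.1 + a.2 * s.time
  left : ∀ a ∈ A, a ∉ l → a.1 < 0 → a.1 + a.2 * s.time < s.pos
  hit_right : ∀ a ∈ l, 0 < a.1 → a.2 < 0 ∧ a.1 + a.2 * s.time ≤ s.pos
  hit_left : ∀ a ∈ l, a.1 < 0 → 0 < a.2 ∧ s.pos ≤ a.1 + a.2 * s.time
  reach : Relation.ReflTransGen (Step m M id) (initState V₀ A) s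
  reach_reflect : Relation.ReflTransGen (Step m M (reflectAt b)) (initState V₀ A) s

theorem History.init {m M b V₀ : ℝ} {A : Set (ℝ × ℝ)} (hV : |V₀| ≤ b) :
    History m M b V₀ A (initState V₀ A) [] where
  vel_eq := rfl
  pos_eq := by simp [initState, pistonLine]
  slow := hV
  nodup := List.nodup_nil
  mem := by simp
  atoms p hp := Or.inl ⟨p, hp, by simp, by simp [initState]⟩
  free a ha _ := by simpa [initState] using ha
  right a _ _ h := by simpa [initState] using h
  left a _ _ h := by simpa [initState] using h
  hit_right := by simp
  hit_left := by simp
  reach := .refl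
  reach_reflect := .refl

/-- The atom outruns the piston in its own direction, so their distance can only grow. -/
theorem Away.not_meets {b : ℝ} {s : State} {p : ℝ × ℝ} {τ : ℝ} (h : Away b s p)
    (hs : |s.vel| ≤ b) : ¬ Meets s p τ := by
  rintro ⟨h1, h2, h3⟩
  obtain ⟨h4, h5⟩ := abs_le.mp hs
  rcases h with ⟨h6, h7⟩ | ⟨h6, h7⟩
  · have := lt_of_le_of_ne h6 (Ne.symm h2)
    nlinarith
  · have := lt_of_le_of_ne h6 h2
    nlinarith

/-- No collision takes place in the interval of times from `s.time` to `t`. -/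
def QuietUntil (s : State) (t : ℝ) : Prop :=
  ∀ a ∈ s.atoms, ∀ τ, Meets s a τ → t < s.time + τ

/-- The two collision rules agree as long as the elastic velocity stays within `b`; this is the only
comparison of the two dynamics. -/
theorem reflectAt_of_abs_le {b w : ℝ} (h : |w| ≤ b) : reflectAt b w = w := by
  obtain ⟨h1, h2⟩ := abs_le.mp h
  unfold reflectAt
  rw [if_neg (by linarith), if_neg (by linarith)]

/-! ### The first collision after a state, and the invariant after it -/

section

variable {m M b V₀ vmin vmax : ℝ} {A : Set (ℝ × ℝ)} {s : State} {l : List (ℝ × ℝ)}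

/-- An atom ahead that has not been met before the time `τ` is still ahead. -/
theorem ahead_of_not_meets {p : ℝ × ℝ} {τ : ℝ} (hτ : 0 < τ) (h0 : s.pos < p.1)
    (hn : ∀ σ ≤ τ, ¬ Meets s p σ) : s.pos + s.vel * τ < p.1 + p.2 * τ := by
  by_contra hlt
  push Not at hlt
  have hv : 0 < s.vel - p.2 := by
    by_contra h
    push Not at h
    nlinarith
  refine hn ((p.1 - s.pos) / (s.vel - p.2)) ?_ ⟨?_, h0.ne', ?_⟩
  · rw [div_le_iff₀ hv]; nlinarith
  · exact div_pos (by linarith) hv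
  · field_simp; ring

theorem behind_of_not_meets {p : ℝ × ℝ} {τ : ℝ} (hτ : 0 < τ) (h0 : p.1 < s.pos)
    (hn : ∀ σ ≤ τ, ¬ Meets s p σ) : p.1 + p.2 * τ < s.pos + s.vel * τ := by
  by_contra hlt
  push Not at hlt
  have hv : 0 < p.2 - s.vel := by
    by_contra h
    push Not at h
    nlinarith
  refine hn ((s.pos - p.1) / (p.2 - s.vel)) ?_ ⟨?_, h0.ne, ?_⟩
  · rw [div_le_iff₀ hv]; nlinarith
  · exact div_pos (by linarith) hv
  · field_simp; ring

/-- Relates the collision time measured from the state `s` to the one computed from initial data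
alone, to which the genericity of the gas applies. The denominator is nonzero because the atom is
faster than the piston. -/
theorem History.meetTime_eq (hs : History m M b V₀ A s l) (hR : SlowRegime m M b vmin)
    (hA : RegularGas m M V₀ vmin vmax A) {a : ℝ × ℝ} (ha : a ∈ A) {τ : ℝ}
    (hm : Meets s (a.1 + a.2 * s.time, a.2) τ) :
    meetTime (pistonLine m M V₀ l) a = s.time + τ := by
  have h1 := hm.2.2
  have h2 := hA.lt_speed a ha
  have h3 : a.2 - s.vel ≠ 0 := by
    intro h
    have : a.2 = s.vel := by linarith
    rw [this] at h2
    linarith [hs.slow, hR.b_lt_vmin]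
  unfold meetTime
  rw [← hs.vel_eq, div_eq_iff h3]
  have h4 := hs.pos_eq
  simp only at h1
  linear_combination -h1 - h4

/-- Either no atom meets the piston before the time `t`, or there is a first collision. -/
theorem History.quiet_or_next (hs : History m M b V₀ A s l) (hR : SlowRegime m M b vmin)
    (hA : RegularGas m M V₀ vmin vmax A) (t : ℝ) :
    QuietUntil s t ∨ ∃ a ∈ A, a ∉ l ∧ ∃ τ, s.time + τ ≤ t ∧
      IsNextCollision s (a.1 + a.2 * s.time, a.2) τ := by
  by_cases hq : QuietUntil s t
  · exact Or.inl hq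
  right
  -- Only unmet atoms matter, since met ones are `Away`. Those reaching the piston by time `t` start
  -- in a bounded interval, so they are finitely many.
  let B : Set (ℝ × ℝ) := {a | a ∈ A ∧ a ∉ l ∧ ∃ τ, s.time + τ ≤ t ∧
    Meets s (a.1 + a.2 * s.time, a.2) τ}
  have hB : B.Finite := by
    refine (hA.finite (|s.pos| + b * |t - s.time| + vmax * |t|
      + vmax * |s.time| )).subset ?_
    rintro a ⟨ha, -, τ, hτ, h0, -, h2⟩
    refine ⟨ha, ?_⟩
    have hv := (hA.speed_lt a ha).le
    have e : a.1 = s.pos + s.vel * τ - a.2 * (s.time + τ) := by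
      simp only at h2; linarith
    have h3 : |s.vel * τ| ≤ b * |t - s.time| := by
      rw [abs_mul]
      have : |τ| ≤ |t - s.time| := by
        rw [abs_of_pos h0]; exact le_trans (by linarith) (le_abs_self _)
      exact mul_le_mul hs.slow this (abs_nonneg _) (hR.b_pos.le)
    have h4 : |a.2 * (s.time + τ)| ≤ vmax * |t| + vmax * |s.time| := by
      rw [abs_mul, ← mul_add]
      have : |s.time + τ| ≤ |t| + |s.time| := by
        rw [abs_le]; constructor
        · have := neg_abs_le s.time; have := abs_nonneg t; linarith
        · have := le_abs_self t; have := abs_nonneg s.time; linarith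
      exact mul_le_mul hv this (abs_nonneg _) ((abs_nonneg _).trans hv)
    show |a.1| ≤ _
    rw [e]
    calc _ ≤ |s.pos + s.vel * τ| + |a.2 * (s.time + τ)| := abs_sub _ _
      _ ≤ |s.pos| + |s.vel * τ| + |a.2 * (s.time + τ)| := by
        gcongr; exact abs_add_le _ _
      _ ≤ _ := by linarith
  have hne : B.Nonempty := by
    unfold QuietUntil at hq
    push Not at hq
    obtain ⟨p, hp, τ, hm, ht⟩ := hq
    rcases hs.atoms p hp with ⟨a, ha, hal, rfl⟩ | haw
    · exact ⟨a, ha, hal, τ, ht, hm⟩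
    · exact absurd hm (haw.not_meets hs.slow)
  -- On `B` the value `meetTime` is the actual collision time, so a minimizer collides first; ties
  -- are excluded below.
  obtain ⟨a, ⟨ha, hal, τ, hτ, hm⟩, hmin⟩ :=
    Set.exists_min_image B (fun a => meetTime (pistonLine m M V₀ l) a) hB hne
  refine ⟨a, ha, hal, τ, hτ, hs.free a ha hal, hm, ?_⟩
  intro p hp hpa σ hσ hmp
  rcases hs.atoms p hp with ⟨c, hc, hcl, rfl⟩ | haw
  · have hca : c ≠ a := by rintro rfl; exact hpa rfl
    have h1 := hmin c ⟨hc, hcl, σ, by linarith, hmp⟩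
    simp only [hs.meetTime_eq hR hA ha hm, hs.meetTime_eq hR hA hc hmp] at h1
    have h2 : σ = τ := by linarith
    subst h2
    -- A tie would put `c` at the place of `a` at the time when `a` meets the line determined by
    -- `l`.
    refine hA.generic l a c ?_ ?_ ?_
    · simp [hca, hal, hcl, hs.nodup]
    · simp only [List.mem_cons]
      rintro x (rfl | rfl | hx)
      exacts [hc, ha, hs.mem x hx]
    · rw [hs.meetTime_eq hR hA ha hm]
      have e1 := hm.2.2
      have e2 := hmp.2.2
      simp only at e1 e2
      linarith
  · exact haw.not_meets hs.slow hmp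

/-- The invariant survives a collision that leaves the piston within `b`: unmet atoms cannot change
sides without a meeting, the atom just hit becomes `Away`, and the lines of atoms hit earlier recede
further. By `hV` the reflection does nothing, so the step belongs to both dynamics. -/
theorem History.collide (hs : History m M b V₀ A s l) (hR : SlowRegime m M b vmin)
    (hA : RegularGas m M V₀ vmin vmax A) {a : ℝ × ℝ} (ha : a ∈ A) (hal : a ∉ l) {τ : ℝ}
    (hn : IsNextCollision s (a.1 + a.2 * s.time, a.2) τ)
    (hV : |pistonAfter m M s.vel a.2| ≤ b) :
    History m M b V₀ A (s.collide m M id (a.1 + a.2 * s.time, a.2) τ) (a :: l) := by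
  obtain ⟨-, hm, hfirst⟩ := id hn
  have hτ := hm.1
  have hmeet := hm.2.2
  simp only at hmeet
  have htime := hs.meetTime_eq hR hA ha hm
  have hvel := hs.vel_eq
  have hb := hR.b_lt_vmin
  obtain ⟨hs1, hs2⟩ := abs_le.mp hs.slow
  have hne : ∀ c : ℝ × ℝ, c ≠ a → (c.1 + c.2 * s.time, c.2) ≠ (a.1 + a.2 * s.time, a.2) := by
    intro c hc h
    simp only [Prod.mk.injEq] at h
    apply hc
    ext
    · have := h.1; rw [h.2] at this; linarith
    · exact h.2
  have hsign : ∀ c ∈ A, c.2 < -vmin ∨ vmin < c.2 := fun c hc =>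
    (lt_abs.mp (hA.lt_speed c hc)).symm.imp_left (by intro h; linarith)
  have hr : 0 < a.1 → a.2 < -vmin := by
    intro h
    have h1 := hs.right a ha hal h
    rcases hsign a ha with h2 | h2
    · exact h2
    · nlinarith
  have hl : a.1 < 0 → vmin < a.2 := by
    intro h
    have h1 := hs.left a ha hal h
    rcases hsign a ha with h2 | h2
    · nlinarith
    · exact h2
  have hrefl : s.collide m M (reflectAt b) (a.1 + a.2 * s.time, a.2) τ
      = s.collide m M id (a.1 + a.2 * s.time, a.2) τ := by
    simp only [State.collide, reflectAt_of_abs_le hV, id]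
  have hfree : ∀ c ∈ A, c ∉ a :: l → ∀ σ ≤ τ, ¬ Meets s (c.1 + c.2 * s.time, c.2) σ := by
    intro c hc hcl σ hσ
    simp only [List.mem_cons, not_or] at hcl
    exact hfirst _ (hs.free c hc hcl.2) (hne c hcl.1) σ hσ
  constructor
  · simp only [State.collide, pistonLine, id, hvel]
  · simp only [State.collide, pistonLine, id, htime, ← hvel]
    linear_combination -hmeet
  · exact hV
  · exact List.nodup_cons.mpr ⟨hal, hs.nodup⟩
  · simp only [List.mem_cons]
    rintro x (rfl | hx)
    exacts [ha, hs.mem x hx]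
  -- The atom just hit returns to the side it came from; all others only move freely.
  · rintro p (rfl | ⟨q, ⟨hq, hqa⟩, rfl⟩)
    · right
      rcases lt_or_gt_of_ne (hA.ne_zero a ha) with h | h
      · right
        exact ⟨le_rfl, hR.atomAfter_lt hs.slow (hl h)⟩
      · left
        exact ⟨le_rfl, hR.lt_atomAfter hs.slow (hr h)⟩
    · rcases hs.atoms q hq with ⟨c, hc, hcl, rfl⟩ | haw
      · left
        refine ⟨c, hc, ?_, ?_⟩
        · simp only [List.mem_cons, not_or]
          exact ⟨by rintro rfl; exact hqa rfl, hcl⟩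
        · simp only [State.collide, Prod.mk.injEq, and_true]; ring
      · right
        rcases haw with ⟨h1, h2⟩ | ⟨h1, h2⟩
        · left
          simp only [State.collide]
          exact ⟨by nlinarith, h2⟩
        · right
          simp only [State.collide]
          exact ⟨by nlinarith, h2⟩
  · intro c hc hcl
    simp only [List.mem_cons, not_or] at hcl
    right
    refine ⟨_, ⟨hs.free c hc hcl.2, hne c hcl.1⟩, ?_⟩
    simp only [State.collide, Prod.mk.injEq, and_true]; ring
  · intro c hc hcl h
    have h1 := ahead_of_not_meets hτ
      (hs.right c hc (fun h => hcl (List.mem_cons_of_mem _ h)) h) (hfree c hc hcl)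
    simp only [State.collide]
    simp only at h1
    linarith
  · intro c hc hcl h
    have h1 := behind_of_not_meets hτ
      (hs.left c hc (fun h => hcl (List.mem_cons_of_mem _ h)) h) (hfree c hc hcl)
    simp only [State.collide]
    simp only at h1
    linarith
  · intro c hc h
    simp only [State.collide]
    rcases List.mem_cons.mp hc with rfl | hc
    · exact ⟨by linarith [hr h, hR.vmin_pos], by linarith⟩
    · obtain ⟨h1, h2⟩ := hs.hit_right c hc h
      refine ⟨h1, ?_⟩
      rcases hsign c (hs.mem c hc) with h3 | h3
      · nlinarith
      · linarith [hR.vmin_pos]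
  · intro c hc h
    simp only [State.collide]
    rcases List.mem_cons.mp hc with rfl | hc
    · exact ⟨by linarith [hl h, hR.vmin_pos], by linarith⟩
    · obtain ⟨h1, h2⟩ := hs.hit_left c hc h
      refine ⟨h1, ?_⟩
      rcases hsign c (hs.mem c hc) with h3 | h3
      · linarith [hR.vmin_pos]
      · nlinarith
  · exact hs.reach.tail ⟨_, τ, hn, rfl⟩
  · exact hs.reach_reflect.tail ⟨_, τ, hn, hrefl.symm⟩

end

/-! ### The velocity of the piston in a window of time -/

/-- The position at the time `t` of the piston in free motion from the state `s`. -/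
def State.posAt (s : State) (t : ℝ) : ℝ := s.pos + s.vel * (t - s.time)

/-- `History` at the time `t`: the last collision before `t` has led to the state `s`. -/
structure HistoryAt (m M b V₀ : ℝ) (A : Set (ℝ × ℝ)) (t : ℝ) (s : State) (l : List (ℝ × ℝ)) :
    Prop where
  history : History m M b V₀ A s l
  time_le : s.time ≤ t
  quiet : QuietUntil s t

section

variable {m M b V₀ vmin vmax t : ℝ} {A : Set (ℝ × ℝ)} {s : State} {l : List (ℝ × ℝ)}

theorem HistoryAt.velocities (h : HistoryAt m M b V₀ A t s l) :
    ∃ v, TrueVelocity m M V₀ A t v ∧ MarkovVelocity m M b V₀ A t v :=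
  ⟨s.vel, ⟨s, h.history.reach, h.time_le, h.quiet, rfl⟩,
    ⟨s, h.history.reach_reflect, h.time_le, h.quiet, rfl⟩⟩

theorem HistoryAt.right (h : HistoryAt m M b V₀ A t s l) {a : ℝ × ℝ} (ha : a ∈ A) (hal : a ∉ l)
    (h0 : 0 < a.1) : s.posAt t < a.1 + a.2 * t := by
  have h1 := h.history.right a ha hal h0
  rcases h.time_le.eq_or_lt with h2 | h2
  · rw [← h2]; simpa [State.posAt] using h1
  · have := ahead_of_not_meets (s := s) (p := (a.1 + a.2 * s.time, a.2)) (τ := t - s.time)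
      (by linarith) h1 (fun σ hσ hm => by
        have := h.quiet _ (h.history.free a ha hal) σ hm
        linarith)
    unfold State.posAt
    simp only at this
    linarith

theorem HistoryAt.left (h : HistoryAt m M b V₀ A t s l) {a : ℝ × ℝ} (ha : a ∈ A) (hal : a ∉ l)
    (h0 : a.1 < 0) : a.1 + a.2 * t < s.posAt t := by
  have h1 := h.history.left a ha hal h0
  rcases h.time_le.eq_or_lt with h2 | h2
  · rw [← h2]; simpa [State.posAt] using h1
  · have := behind_of_not_meets (s := s) (p := (a.1 + a.2 * s.time, a.2)) (τ := t - s.time)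
      (by linarith) h1 (fun σ hσ hm => by
        have := h.quiet _ (h.history.free a ha hal) σ hm
        linarith)
    unfold State.posAt
    simp only at this
    linarith

/-- The line of a hit atom, continued through the piston, stays beyond it, because its speed exceeds
`vmin > b`. Together with `HistoryAt.right` this decides from initial data and the position of the
piston whether an atom has been met. -/
theorem HistoryAt.hit_right (h : HistoryAt m M b V₀ A t s l) (hR : SlowRegime m M b vmin)
    (hA : RegularGas m M V₀ vmin vmax A) {a : ℝ × ℝ} (hal : a ∈ l) (h0 : 0 < a.1) :
    a.2 < -vmin ∧ a.1 + a.2 * t ≤ s.posAt t := by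
  obtain ⟨h1, h2⟩ := h.history.hit_right a hal h0
  have h3 := hA.lt_speed a (h.history.mem a hal)
  rw [abs_of_neg h1] at h3
  have h4 := (abs_le.mp h.history.slow).1
  have h5 := hR.b_lt_vmin
  have h6 := h.time_le
  unfold State.posAt
  exact ⟨by linarith, by nlinarith⟩

theorem HistoryAt.hit_left (h : HistoryAt m M b V₀ A t s l) (hR : SlowRegime m M b vmin)
    (hA : RegularGas m M V₀ vmin vmax A) {a : ℝ × ℝ} (hal : a ∈ l) (h0 : a.1 < 0) :
    vmin < a.2 ∧ s.posAt t ≤ a.1 + a.2 * t := by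
  obtain ⟨h1, h2⟩ := h.history.hit_left a hal h0
  have h3 := hA.lt_speed a (h.history.mem a hal)
  rw [abs_of_pos h1] at h3
  have h4 := (abs_le.mp h.history.slow).2
  have h5 := hR.b_lt_vmin
  have h6 := h.time_le
  unfold State.posAt
  exact ⟨by linarith, by nlinarith⟩

end

/-- From the time `t₀` and the state `s₀` to the time `t` and the state `s` the piston has met the
atoms of the list `l`, and its velocity has changed by at most `w`. -/
structure Window (m M b V₀ vmax w : ℝ) (A : Set (ℝ × ℝ)) (t₀ : ℝ) (s₀ : State)
    (l₀ : List (ℝ × ℝ)) (t : ℝ) (s : State) (l : List (ℝ × ℝ)) : Prop where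
  at_end : HistoryAt m M b V₀ A t s (l ++ l₀)
  vel_sub : |s.vel - s₀.vel| ≤ kick m M * (2 * vmax) * l.length
  vel_sub_le : |s.vel - s₀.vel| ≤ w
  upper : ∀ c ≤ s₀.vel - w, s.vel ≤ s₀.vel + kick m M * (l.map fun a => a.2 - c).sum
  lower : ∀ c, s₀.vel + w ≤ c → s₀.vel + kick m M * (l.map fun a => a.2 - c).sum ≤ s.vel
  pos_ge : ∀ c ≤ s₀.vel - w, s₀.posAt t₀ + c * (t - t₀) ≤ s.posAt t
  pos_le : ∀ c, s₀.vel + w ≤ c → s.posAt t ≤ s₀.posAt t₀ + c * (t - t₀)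

section

variable {m M b V₀ vmin vmax w t₀ t₁ t : ℝ} {A : Set (ℝ × ℝ)} {s₀ s : State}
  {l₀ l : List (ℝ × ℝ)}

theorem State.posAt_add (s : State) (t t' : ℝ) : s.posAt t' = s.posAt t + s.vel * (t' - t) := by
  unfold State.posAt; ring

theorem Window.refl (h : HistoryAt m M b V₀ A t₀ s₀ l₀) (hw : 0 ≤ w) :
    Window m M b V₀ vmax w A t₀ s₀ l₀ t₀ s₀ [] where
  at_end := h
  vel_sub := by simp
  vel_sub_le := by simpa using hw
  upper c _ := by simp
  lower c _ := by simp
  pos_ge c _ := by simp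
  pos_le c _ := by simp

theorem Window.posAt_ge (h : Window m M b V₀ vmax w A t₀ s₀ l₀ t s l) {t' : ℝ} (ht : t ≤ t')
    {c : ℝ} (hc : c ≤ s₀.vel - w) : s₀.posAt t₀ + c * (t' - t₀) ≤ s.posAt t' := by
  have h1 := h.pos_ge c hc
  have h2 := (abs_le.mp h.vel_sub_le).1
  rw [s.posAt_add t t']
  nlinarith

theorem Window.posAt_le (h : Window m M b V₀ vmax w A t₀ s₀ l₀ t s l) {t' : ℝ} (ht : t ≤ t')
    {c : ℝ} (hc : s₀.vel + w ≤ c) : s.posAt t' ≤ s₀.posAt t₀ + c * (t' - t₀) := by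
  have h1 := h.pos_le c hc
  have h2 := (abs_le.mp h.vel_sub_le).2
  rw [s.posAt_add t t']
  nlinarith

theorem Window.extend (h : Window m M b V₀ vmax w A t₀ s₀ l₀ t s l) {t' : ℝ} (ht : t ≤ t')
    (hq : QuietUntil s t') : Window m M b V₀ vmax w A t₀ s₀ l₀ t' s l where
  at_end := ⟨h.at_end.history, h.at_end.time_le.trans ht, hq⟩
  vel_sub := h.vel_sub
  vel_sub_le := h.vel_sub_le
  upper := h.upper
  lower := h.lower
  pos_ge _ hc := h.posAt_ge ht hc
  pos_le _ hc := h.posAt_le ht hc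

/-- The atoms that are met between the times `t₀` and `t₁` are near the piston at the time `t₀`. -/
theorem Window.near (h : Window m M b V₀ vmax w A t₀ s₀ l₀ t s l)
    (h₀ : HistoryAt m M b V₀ A t₀ s₀ l₀) (hR : SlowRegime m M b vmin)
    (hA : RegularGas m M V₀ vmin vmax A) (hv : vmin < vmax) (hb : |s₀.vel| + w ≤ b)
    {t' : ℝ} (ht₀ : t₀ ≤ t) (ht : t ≤ t') (ht₁ : t' ≤ t₁) {a : ℝ × ℝ} (ha : a ∈ A) (hal : a ∉ l₀)
    (hhit : a.1 + a.2 * t' = s.posAt t' ∨ a ∈ l) :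
    |a.1 + a.2 * t₀ - s₀.posAt t₀| ≤ 2 * vmax * (t₁ - t₀) := by
  have hp := h.posAt_ge ht (c := -b) (by linarith [neg_abs_le s₀.vel])
  have hp' := h.posAt_le ht (c := b) (by linarith [le_abs_self s₀.vel])
  have hs := hA.speed_lt a ha
  obtain ⟨hs1, hs2⟩ := abs_lt.mp hs
  have hbv := hR.b_lt_vmin
  have hd : b * (t' - t₀) ≤ vmax * (t₁ - t₀) :=
    mul_le_mul (by linarith) (by linarith) (by linarith) (by linarith [hR.vmin_pos])
  have hvp := hR.vmin_pos
  have e1 : |a.2 * (t' - t₀)| ≤ vmax * (t₁ - t₀) := by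
    rw [abs_mul, abs_of_nonneg (by linarith : 0 ≤ t' - t₀)]
    exact mul_le_mul hs.le (by linarith) (by linarith) (by linarith)
  obtain ⟨e2, e3⟩ := abs_le.mp e1
  rw [abs_le]
  rcases lt_or_gt_of_ne (hA.ne_zero a ha) with h0 | h0
  · have h1 := h₀.left ha hal h0
    have h2 : s.posAt t' ≤ a.1 + a.2 * t' := by
      rcases hhit with h | h'
      · exact h.ge
      · obtain ⟨g1, g2⟩ := h.at_end.hit_left hR hA (List.mem_append_left _ h') h0
        have := (abs_le.mp h.at_end.history.slow).2
        rw [s.posAt_add t t']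
        nlinarith
    constructor <;> nlinarith
  · have h1 := h₀.right ha hal h0
    have h2 : a.1 + a.2 * t' ≤ s.posAt t' := by
      rcases hhit with h | h'
      · exact h.le
      · obtain ⟨g1, g2⟩ := h.at_end.hit_right hR hA (List.mem_append_left _ h') h0
        have := (abs_le.mp h.at_end.history.slow).1
        rw [s.posAt_add t t']
        nlinarith
    constructor <;> nlinarith

/-- If the atoms near the piston are few, the dynamics is defined in the window. -/
theorem HistoryAt.exists_window (h₀ : HistoryAt m M b V₀ A t₀ s₀ l₀) (hR : SlowRegime m M b vmin)
    (hA : RegularGas m M V₀ vmin vmax A) (hv : vmin < vmax) (hw : 0 ≤ w) (hb : |s₀.vel| + w ≤ b)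
    {N : ℕ} (F : Finset (ℝ × ℝ)) (hF : F.card ≤ N) (hN : kick m M * (2 * vmax) * N ≤ w)
    (hnear : ∀ a ∈ A, |a.1 + a.2 * t₀ - s₀.posAt t₀| ≤ 2 * vmax * (t₁ - t₀) → a ∈ F)
    (ht : t₀ ≤ t) (ht₁ : t ≤ t₁) :
    ∃ s l, Window m M b V₀ vmax w A t₀ s₀ l₀ t s l := by
  have hkick := kick_pos hR.m_pos hR.M_pos
  have hvmax : 0 < vmax := hR.vmin_pos.trans hv
  -- Here `n` bounds the number of further collisions: the atoms met in the window are distinct and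
  -- lie in `F`, so there are at most `N`.
  have key : ∀ n : ℕ, ∀ t' s l, t₀ ≤ t' → t' ≤ t → Window m M b V₀ vmax w A t₀ s₀ l₀ t' s l →
      N ≤ l.length + n → ∃ s l, Window m M b V₀ vmax w A t₀ s₀ l₀ t s l := by
    intro n
    induction n using Nat.strong_induction_on with
    | _ n ih =>
      intro t' s l ht' htt hW hn
      rcases hW.at_end.history.quiet_or_next hR hA t with hq | ⟨a, ha, hal, τ, hτ, hnext⟩
      · exact ⟨s, l, hW.extend htt hq⟩
      · have hlt := hW.at_end.quiet _ hnext.1 τ hnext.2.1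
        have hmeet := hnext.2.1.2.2
        simp only at hmeet
        have halA := hal
        simp only [List.mem_append, not_or] at hal
        have hnodup := (List.nodup_append.mp hW.at_end.history.nodup)
        have hsub : ∀ x ∈ a :: l, x ∈ F := by
          intro x hx
          rcases List.mem_cons.mp hx with rfl | hx
          · refine hnear x ha (hW.near h₀ hR hA hv hb (t' := s.time + τ) ht' hlt.le
              (hτ.trans ht₁) ha hal.2 (Or.inl ?_))
            unfold State.posAt; linarith
          · have hxA := hW.at_end.history.mem x (List.mem_append_left _ hx)
            refine hnear x hxA (hW.near h₀ hR hA hv hb ht' le_rfl (htt.trans ht₁) hxA ?_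
              (Or.inr hx))
            intro hx'
            exact hnodup.2.2 x hx x hx' rfl
        have hcard : (a :: l).toFinset.card = l.length + 1 := by
          rw [List.toFinset_card_of_nodup (List.nodup_cons.mpr ⟨hal.1, hnodup.1⟩)]; rfl
        have hlen := Finset.card_le_card (s := (a :: l).toFinset) (t := F)
          (fun x hx => hsub x (List.mem_toFinset.mp hx))
        have hlenN : ((l.length : ℝ) + 1) ≤ N := by exact_mod_cast (hcard ▸ hlen.trans hF)
        have hafter := pistonAfter_eq (add_pos hR.M_pos hR.m_pos) s.vel a.2
        have hsv := hW.at_end.history.slow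
        have hdiff : |a.2 - s.vel| ≤ 2 * vmax := by
          have h1 := (hA.speed_lt a ha).le
          have := abs_sub a.2 s.vel
          linarith [hR.b_lt_vmin]
        have hstep : |pistonAfter m M s.vel a.2 - s₀.vel|
            ≤ kick m M * (2 * vmax) * ((l.length : ℝ) + 1) := by
          rw [hafter]
          calc |s.vel + kick m M * (a.2 - s.vel) - s₀.vel|
              = |(s.vel - s₀.vel) + kick m M * (a.2 - s.vel)| := by ring_nf
            _ ≤ |s.vel - s₀.vel| + |kick m M * (a.2 - s.vel)| := abs_add_le _ _
            _ ≤ kick m M * (2 * vmax) * l.length + kick m M * (2 * vmax) := by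
                rw [abs_mul, abs_of_pos hkick]
                gcongr
                exact hW.vel_sub
            _ = _ := by ring
        have hstepw : |pistonAfter m M s.vel a.2 - s₀.vel| ≤ w :=
          hstep.trans (le_trans (by gcongr) hN)
        have hslow : |pistonAfter m M s.vel a.2| ≤ b := by
          have := abs_sub_abs_le_abs_sub (pistonAfter m M s.vel a.2) s₀.vel
          linarith
        have hH := hW.at_end.history.collide hR hA ha halA hnext hslow
        have hpos : (s.collide m M id (a.1 + a.2 * s.time, a.2) τ).posAt (s.time + τ)
            = s.posAt (s.time + τ) := by
          simp only [State.posAt, State.collide]; ring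
        obtain ⟨hvs1, hvs2⟩ := abs_le.mp hW.vel_sub_le
        refine ih (n - 1) (by omega) (s.time + τ) (s.collide m M id (a.1 + a.2 * s.time, a.2) τ) (a :: l)
          (by linarith) hτ ⟨⟨hH, le_rfl, ?_⟩, ?_, ?_, ?_, ?_, ?_, ?_⟩ ?_
        · intro p _ σ hσ
          have := hσ.1
          simp only [State.collide]
          linarith
        · simpa [State.collide] using hstep
        · simpa [State.collide] using hstepw
        -- Within the window the velocity is at least `s₀.vel - w ≥ c`, so the increment `kick *
        -- (a.2 - V)` is at most `kick * (a.2 - c)`.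
        · intro c hc
          have h1 := hW.upper c hc
          simp only [State.collide, id, hafter, List.map_cons, List.sum_cons]
          nlinarith
        · intro c hc
          have h1 := hW.lower c hc
          simp only [State.collide, id, hafter, List.map_cons, List.sum_cons]
          nlinarith
        · intro c hc
          rw [hpos]
          exact hW.posAt_ge hlt.le hc
        · intro c hc
          rw [hpos]
          exact hW.posAt_le hlt.le hc
        · simp only [List.length_cons]; omega
  exact key N t₀ s₀ [] le_rfl ht (Window.refl h₀ hw) (by simp)

end

/-! ### The restoring force -/

/-- The atoms from the side `σ = 1` (right) or `σ = -1` (left) with speed in `[u, u')` that at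
the time `t₀` are beyond `lo` and at the time `t₁` before `hi`, in free motion. -/
def crossing (σ lo hi t₀ t₁ u u' : ℝ) : Set (ℝ × ℝ) :=
  {a | 0 < σ * a.1 ∧ u ≤ -(σ * a.2) ∧ -(σ * a.2) < u' ∧ lo ≤ σ * a.1 + σ * a.2 * t₀ ∧
    σ * a.1 + σ * a.2 * t₁ ≤ hi}

/-- The number of points of `A` in `D` is finite and at most `r`. -/
def CountLE (A D : Set (ℝ × ℝ)) (r : ℝ) : Prop :=
  ∃ n : ℕ, (A ∩ D).encard = n ∧ (n : ℝ) ≤ r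

/-- The number of points of `A` in `D` is infinite or at least `r`. -/
def CountGE (A D : Set (ℝ × ℝ)) (r : ℝ) : Prop :=
  ∀ n : ℕ, (A ∩ D).encard = n → r ≤ (n : ℝ)

theorem CountLE.exists_finset {A D : Set (ℝ × ℝ)} {r : ℝ} (h : CountLE A D r) :
    ∃ F : Finset (ℝ × ℝ), (F : Set (ℝ × ℝ)) = A ∩ D ∧ (F.card : ℝ) ≤ r := by
  obtain ⟨n, hn, hr⟩ := h
  have hfin : (A ∩ D).Finite := Set.finite_of_encard_eq_coe hn
  refine ⟨hfin.toFinset, hfin.coe_toFinset, ?_⟩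
  rw [hfin.encard_eq_coe_toFinset_card] at hn
  have : hfin.toFinset.card = n := by exact_mod_cast hn
  rwa [this]

theorem CountLE.card_le {A D : Set (ℝ × ℝ)} {r : ℝ} (h : CountLE A D r) (P : Finset (ℝ × ℝ))
    (hP : ∀ a ∈ P, a ∈ A ∩ D) : (P.card : ℝ) ≤ r := by
  obtain ⟨F, hF, hr⟩ := h.exists_finset
  have : P.card ≤ F.card := Finset.card_le_card fun a ha => by
    have := hP a ha
    rwa [← hF, Finset.mem_coe] at this
  exact le_trans (by exact_mod_cast this) hr

theorem CountGE.le_card {A D : Set (ℝ × ℝ)} {r : ℝ} (h : CountGE A D r) (Q : Finset (ℝ × ℝ))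
    (hQ : ∀ a ∈ A ∩ D, a ∈ Q) : r ≤ (Q.card : ℝ) := by
  have hfin : (A ∩ D).Finite := Q.finite_toSet.subset hQ
  have h1 := h _ hfin.encard_eq_coe_toFinset_card
  refine h1.trans ?_
  exact_mod_cast Finset.card_le_card fun a ha => hQ a (hfin.mem_toFinset.mp ha)

/-! ### Momentum balance with speeds sorted into bins -/

/-- The bin of length `δ` above `vmin` that contains the speed `u`. -/
noncomputable def speedBin (vmin δ u : ℝ) : ℕ := ⌊(u - vmin) / δ⌋₊

theorem speedBin_bounds {vmin δ u : ℝ} (hδ : 0 < δ) (hu : vmin ≤ u) :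
    vmin + speedBin vmin δ u * δ ≤ u ∧ u < vmin + (speedBin vmin δ u + 1 : ℕ) * δ := by
  have h0 : 0 ≤ (u - vmin) / δ := div_nonneg (by linarith) hδ.le
  have h1 := Nat.floor_le h0
  have h2 := Nat.lt_floor_add_one ((u - vmin) / δ)
  rw [le_div_iff₀ hδ] at h1
  rw [div_lt_iff₀ hδ] at h2
  unfold speedBin
  push_cast
  constructor <;> linarith

theorem speedBin_lt {vmin δ u : ℝ} {K : ℕ} (hδ : 0 < δ) (hu : vmin ≤ u) (hK : u < vmin + K * δ) :
    speedBin vmin δ u < K := by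
  have h1 := (speedBin_bounds hδ hu).1
  have : (speedBin vmin δ u : ℝ) < K := by
    by_contra h
    push Not at h
    nlinarith
  exact_mod_cast this

/-- Drag against errors. `P` and `Q` are the densities of pushing and braking atoms per bin, and
`hPQ` is pressure balance with speeds rounded down for `P` and up for `Q`. The shift by `c` changes
each term to first order. On the `Q` side this gain pays for the rounding; on the `P` side it also
leaves `P i * (c * vmin / 2)`. Summed over the bins this is at least `g * (c * vmin / 2)`, which by
`h2` covers the additive errors, at most `3 * vmax * K * η` in total. -/
theorem bin_balance {vmin vmax c δ η g : ℝ} {K : ℕ} {P Q : ℕ → ℝ} (hvmin : 0 < vmin)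
    (hc : 0 < c) (hcv : c ≤ vmin) (hδ : 0 < δ) (hη : 0 < η) (hK : vmin + K * δ = vmax)
    (hP : ∀ i, 0 ≤ P i) (hQ : ∀ i, 0 ≤ Q i)
    (hPQ : ∑ i ∈ Finset.range K, P i * (vmin + i * δ) ^ 2
      ≤ ∑ i ∈ Finset.range K, Q i * (vmin + (i + 1 : ℕ) * δ) ^ 2)
    (hg : g ≤ ∑ i ∈ Finset.range K, P i)
    (h1 : 4 * vmax * (δ + η) ≤ c * vmin) (h2 : 6 * vmax * K * η ≤ g * (c * vmin)) :
    ∑ i ∈ Finset.range K, (vmin + (i + 1 : ℕ) * δ - c) * (P i * (vmin + (i + 1 : ℕ) * δ + η) + η)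
      ≤ ∑ i ∈ Finset.range K, (vmin + i * δ + c) * (Q i * (vmin + i * δ - η) - η) := by
  have hcvm : 0 < c * vmin := mul_pos hc hvmin
  have hu : ∀ i ∈ Finset.range K, vmin ≤ vmin + i * δ ∧ vmin + i * δ + δ ≤ vmax := by
    intro i hi
    have : (i : ℝ) + 1 ≤ K := by exact_mod_cast Finset.mem_range.mp hi
    constructor
    · have : 0 ≤ (i : ℝ) * δ := by positivity
      linarith
    · nlinarith
  have t1 : ∀ i ∈ Finset.range K,
      (vmin + (i + 1 : ℕ) * δ - c) * (P i * (vmin + (i + 1 : ℕ) * δ + η) + η)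
        ≤ P i * (vmin + i * δ) ^ 2 - P i * (c * vmin / 2) + vmax * η := by
    intro i hi
    obtain ⟨g1, g2⟩ := hu i hi
    push_cast
    set u := vmin + i * δ
    have e : vmin + ((i : ℝ) + 1) * δ = u + δ := by simp only [u]; ring
    rw [e]
    have g3 : (u + δ - c) * (u + δ + η) ≤ u ^ 2 - c * vmin / 2 := by
      nlinarith [mul_nonneg hδ.le (by linarith : 0 ≤ vmax - u - δ), mul_pos hδ hδ,
        mul_nonneg hη.le (by linarith : 0 ≤ vmax - u - δ), mul_pos hc hη, mul_pos hc hδ,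
        mul_nonneg hc.le (by linarith : 0 ≤ u - vmin), mul_pos hδ hvmin,
        mul_pos hη hvmin]
    have g4 := mul_le_mul_of_nonneg_left g3 (hP i)
    nlinarith [mul_nonneg hη.le (by linarith : 0 ≤ vmax - (u + δ - c))]
  have t2 : ∀ i ∈ Finset.range K,
      Q i * (vmin + (i + 1 : ℕ) * δ) ^ 2 - 2 * vmax * η
        ≤ (vmin + i * δ + c) * (Q i * (vmin + i * δ - η) - η) := by
    intro i hi
    obtain ⟨g1, g2⟩ := hu i hi
    push_cast
    set u := vmin + i * δ
    have e : vmin + ((i : ℝ) + 1) * δ = u + δ := by simp only [u]; ring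
    rw [e]
    have g3 : (u + δ) ^ 2 ≤ (u + c) * (u - η) := by
      nlinarith [mul_nonneg hδ.le (by linarith : 0 ≤ vmax - u - δ), mul_pos hδ hδ,
        mul_nonneg hη.le (by linarith : 0 ≤ vmax - u - δ), mul_nonneg hη.le
        (by linarith : 0 ≤ vmin - c), mul_nonneg hc.le (by linarith : 0 ≤ u - vmin),
        mul_pos hδ hvmin, mul_pos hη hvmin]
    have g4 := mul_le_mul_of_nonneg_left g3 (hQ i)
    nlinarith [mul_nonneg hη.le (by linarith : 0 ≤ 2 * vmax - (u + c))]
  refine (Finset.sum_le_sum t1).trans (le_trans ?_ (Finset.sum_le_sum t2))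
  simp only [Finset.sum_add_distrib, Finset.sum_sub_distrib, Finset.sum_const, Finset.card_range,
    nsmul_eq_mul, ← Finset.sum_mul]
  have : g * (c * vmin / 2) ≤ (∑ i ∈ Finset.range K, P i) * (c * vmin / 2) := by gcongr
  nlinarith

/-- The momentum of the atoms in `P`, which push a piston of velocity `c`, against that of the
atoms in `Q`, which brake it. -/
theorem momentum_le {vmin vmax c δ : ℝ} {K : ℕ} {up lo : ℕ → ℝ} (P Q : Finset (ℝ × ℝ))
    (hvmin : 0 < vmin) (hc : 0 < c) (hcv : c ≤ vmin) (hδ : 0 < δ) (hK : vmin + K * δ = vmax)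
    (hP : ∀ a ∈ P, vmin < |a.2| ∧ |a.2| < vmax) (hQ : ∀ a ∈ Q, vmin < |a.2| ∧ |a.2| < vmax)
    (hup : ∀ i < K, ((P.filter fun a => speedBin vmin δ |a.2| = i).card : ℝ) ≤ up i)
    (hlo : ∀ i < K, lo i ≤ ((Q.filter fun a => speedBin vmin δ |a.2| = i).card : ℝ))
    (hbal : ∑ i ∈ Finset.range K, (vmin + (i + 1 : ℕ) * δ - c) * up i
      ≤ ∑ i ∈ Finset.range K, (vmin + i * δ + c) * lo i) :
    ∑ a ∈ P, (|a.2| - c) ≤ ∑ a ∈ Q, (|a.2| + c) := by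
  have hmaps : ∀ R : Finset (ℝ × ℝ), (∀ a ∈ R, vmin < |a.2| ∧ |a.2| < vmax) →
      ∀ a ∈ R, speedBin vmin δ |a.2| ∈ Finset.range K := fun R hR a ha =>
    Finset.mem_range.mpr (speedBin_lt hδ (hR a ha).1.le (hK ▸ (hR a ha).2))
  rw [← Finset.sum_fiberwise_of_maps_to (hmaps P hP), ← Finset.sum_fiberwise_of_maps_to (hmaps Q hQ)]
  refine le_trans (Finset.sum_le_sum fun i hi => ?_)
    (hbal.trans (Finset.sum_le_sum fun i hi => ?_))
  · have h1 : ∀ a ∈ P.filter (fun a => speedBin vmin δ |a.2| = i),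
        |a.2| - c ≤ vmin + (i + 1 : ℕ) * δ - c := by
      intro a ha
      obtain ⟨haP, rfl⟩ := Finset.mem_filter.mp ha
      linarith [(speedBin_bounds hδ (hP a haP).1.le).2]
    refine (Finset.sum_le_card_nsmul _ _ _ h1).trans ?_
    rw [nsmul_eq_mul, mul_comm]
    have : 0 ≤ ((i + 1 : ℕ) : ℝ) * δ := by positivity
    exact mul_le_mul_of_nonneg_left (hup i (Finset.mem_range.mp hi)) (by linarith)
  · have h1 : ∀ a ∈ Q.filter (fun a => speedBin vmin δ |a.2| = i),
        vmin + i * δ + c ≤ |a.2| + c := by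
      intro a ha
      obtain ⟨haQ, rfl⟩ := Finset.mem_filter.mp ha
      linarith [(speedBin_bounds hδ (hQ a haQ).1.le).1]
    refine le_trans ?_ (Finset.card_nsmul_le_sum _ _ _ h1)
    rw [nsmul_eq_mul, mul_comm _ (vmin + _ + _)]
    have : 0 ≤ (i : ℝ) * δ := by positivity
    exact mul_le_mul_of_nonneg_left (hlo i (Finset.mem_range.mp hi)) (by linarith)

section

variable {m M b V₀ vmin vmax w t₀ t₁ t σ : ℝ} {A : Set (ℝ × ℝ)} {s₀ s : State}
  {l₀ l : List (ℝ × ℝ)}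

/-- Multiplication by `σ` reflects the line, so that one argument serves both sides. -/
theorem HistoryAt.side (h : HistoryAt m M b V₀ A t s l) (hσ : σ = 1 ∨ σ = -1) {a : ℝ × ℝ}
    (ha : a ∈ A) (hal : a ∉ l) (h0 : 0 < σ * a.1) :
    σ * s.posAt t < σ * a.1 + σ * a.2 * t := by
  rcases hσ with rfl | rfl
  · have := h.right ha hal (by linarith); linarith
  · have := h.left ha hal (by linarith); linarith

theorem HistoryAt.hit_side (h : HistoryAt m M b V₀ A t s l) (hR : SlowRegime m M b vmin)
    (hA : RegularGas m M V₀ vmin vmax A) (hσ : σ = 1 ∨ σ = -1) {a : ℝ × ℝ} (hal : a ∈ l)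
    (h0 : 0 < σ * a.1) : σ * a.2 = -|a.2| ∧ σ * a.1 + σ * a.2 * t ≤ σ * s.posAt t := by
  have hv := hR.vmin_pos
  rcases hσ with rfl | rfl
  · obtain ⟨h1, h2⟩ := h.hit_right hR hA hal (by linarith)
    rw [abs_of_neg (by linarith)]
    constructor <;> linarith
  · obtain ⟨h1, h2⟩ := h.hit_left hR hA hal (by linarith)
    rw [abs_of_pos (by linarith)]
    constructor <;> linarith

/-- The numbers of atoms from the side `σ` that cross the interval `[p, p + h]` from `t₀` to `t₁`
are, for every bin of speeds, between the given bounds. -/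
def CountsBetween (A : Set (ℝ × ℝ)) (vmin δ h t₀ t₁ : ℝ) (K : ℕ) (up lo : ℕ → ℝ) (σ p : ℝ) :
    Prop :=
  ∀ i < K,
    CountLE A (crossing σ p (p + h) t₀ t₁ (vmin + i * δ) (vmin + (i + 1 : ℕ) * δ)) (up i) ∧
    CountGE A (crossing σ (p + h) p t₀ t₁ (vmin + i * δ) (vmin + (i + 1 : ℕ) * δ)) (lo i)

/-- A piston that moves in the direction `σ` in the whole window is slowed down. -/
theorem Window.slow_down (hW : Window m M b V₀ vmax w A t₀ s₀ l₀ t₁ s l)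
    (h₀ : HistoryAt m M b V₀ A t₀ s₀ l₀) (hR : SlowRegime m M b vmin)
    (hA : RegularGas m M V₀ vmin vmax A) (hσ : σ = 1 ∨ σ = -1) (ht : t₀ ≤ t₁)
    {c δ h : ℝ} {K : ℕ} {up lo : ℕ → ℝ} {p p' : ℝ} (hc : 0 < c) (hcv : c ≤ vmin) (hδ : 0 < δ)
    (hK : vmin + K * δ = vmax) (hcw : c + w ≤ σ * s₀.vel)
    (hp : p ≤ -(σ * s₀.posAt t₀)) (hph : -(σ * s₀.posAt t₀) < p + h)
    (hp' : p' ≤ σ * s₀.posAt t₀) (hph' : σ * s₀.posAt t₀ < p' + h)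
    {lo' up' : ℕ → ℝ}
    (hup : CountsBetween A vmin δ h t₀ t₁ K up lo' (-σ) p)
    (hlo : CountsBetween A vmin δ h t₀ t₁ K up' lo σ p')
    (hbal : ∑ i ∈ Finset.range K, (vmin + (i + 1 : ℕ) * δ - c) * up i
      ≤ ∑ i ∈ Finset.range K, (vmin + i * δ + c) * lo i) :
    σ * s.vel ≤ σ * s₀.vel := by
  classical
  have hσ' : -σ = 1 ∨ -σ = -1 := by rcases hσ with rfl | rfl <;> simp
  have hnodup := List.nodup_append.mp hW.at_end.history.nodup
  -- The piston advances in the direction `σ`, so its initial position bounds its final one. This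
  -- reduces the counts to those for a wall at rest.
  have hpos : σ * s₀.posAt t₀ ≤ σ * s.posAt t₁ := by
    have hct : 0 ≤ c * (t₁ - t₀) := mul_nonneg hc.le (by linarith)
    rcases hσ with rfl | rfl
    · have := hW.pos_ge c (by linarith); linarith
    · have := hW.pos_le (-c) (by linarith); linarith
  have hvel : σ * s.vel ≤ σ * s₀.vel + kick m M * (l.map fun a => σ * a.2 - c).sum := by
    rcases hσ with rfl | rfl
    · have := hW.upper c (by linarith)
      simpa using this
    · have := hW.lower (-c) (by linarith)
      have e : (l.map fun a : ℝ × ℝ => -1 * a.2 - c).sum = -(l.map fun a => a.2 - -c).sum := by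
        rw [List.sum_neg, List.map_map]
        congr 1
        apply List.map_congr_left
        intro a _
        simp only [Function.comp]; ring
      rw [e]; linarith
  have hspeed : ∀ a ∈ l, vmin < |a.2| ∧ |a.2| < vmax := fun a ha =>
    have hm := hW.at_end.history.mem a (List.mem_append_left _ ha)
    ⟨hA.lt_speed a hm, hA.speed_lt a hm⟩
  let Q := l.toFinset.filter fun a => 0 < σ * a.1
  let P := l.toFinset.filter fun a => ¬ 0 < σ * a.1
  have hmemP : ∀ a ∈ P, a ∈ l ∧ 0 < -σ * a.1 := by
    intro a ha
    obtain ⟨h1, h2⟩ := Finset.mem_filter.mp ha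
    rw [List.mem_toFinset] at h1
    refine ⟨h1, ?_⟩
    have := hA.ne_zero a (hW.at_end.history.mem a (List.mem_append_left _ h1))
    have hne : σ * a.1 ≠ 0 := by rcases hσ with rfl | rfl <;> simpa using this
    have := lt_of_le_of_ne (not_lt.mp h2) hne
    linarith
  have hmemQ : ∀ a ∈ Q, a ∈ l ∧ 0 < σ * a.1 := by
    intro a ha
    obtain ⟨h1, h2⟩ := Finset.mem_filter.mp ha
    rw [List.mem_toFinset] at h1
    exact ⟨h1, h2⟩
  have hsum : (l.map fun a => σ * a.2 - c).sum
      = ∑ a ∈ P, (|a.2| - c) - ∑ a ∈ Q, (|a.2| + c) := by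
    rw [← List.sum_toFinset _ hnodup.1,
      ← Finset.sum_filter_add_sum_filter_not l.toFinset (fun a => 0 < σ * a.1)]
    have e1 : ∑ a ∈ Q, (σ * a.2 - c) = -∑ a ∈ Q, (|a.2| + c) := by
      rw [← Finset.sum_neg_distrib]
      refine Finset.sum_congr rfl fun a ha => ?_
      obtain ⟨h1, h2⟩ := hmemQ a ha
      rw [(hW.at_end.hit_side hR hA hσ (List.mem_append_left _ h1) h2).1]; ring
    have e2 : ∑ a ∈ P, (σ * a.2 - c) = ∑ a ∈ P, (|a.2| - c) := by
      refine Finset.sum_congr rfl fun a ha => ?_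
      obtain ⟨h1, h2⟩ := hmemP a ha
      have := (hW.at_end.hit_side hR hA hσ' (List.mem_append_left _ h1) h2).1
      linarith
    change ∑ a ∈ Q, (σ * a.2 - c) + ∑ a ∈ P, (σ * a.2 - c) = _
    rw [e1, e2]; ring
  have hmom : ∑ a ∈ P, (|a.2| - c) ≤ ∑ a ∈ Q, (|a.2| + c) := by
    refine momentum_le P Q hR.vmin_pos hc hcv hδ hK (fun a ha => hspeed a (hmemP a ha).1)
      (fun a ha => hspeed a (hmemQ a ha).1) (fun i hi => ?_) (fun i hi => ?_) hbal
    -- An atom that hits from behind is beyond the initial position at `t₀` and has passed the final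
    -- one, hence also the initial one, at `t₁`.
    · refine (hup i hi).1.card_le _ fun a ha => ?_
      obtain ⟨haP, hbin⟩ := Finset.mem_filter.mp ha
      obtain ⟨h1, h2⟩ := hmemP a haP
      have haA := hW.at_end.history.mem a (List.mem_append_left _ h1)
      obtain ⟨h3, h4⟩ := hW.at_end.hit_side hR hA hσ' (List.mem_append_left _ h1) h2
      have h5 := h₀.side hσ' haA (fun h => hnodup.2.2 a h1 a h rfl) h2
      have h6 := speedBin_bounds hδ (hspeed a h1).1.le
      rw [hbin] at h6
      refine ⟨haA, h2, ?_, ?_, ?_, ?_⟩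
      · rw [h3]; linarith
      · rw [h3]; linarith
      · linarith
      · linarith
    -- Conversely, an atom in front that crosses the whole cell is unmet at `t₀` and cannot be unmet
    -- at `t₁`.
    · refine (hlo i hi).2.le_card _ fun a ha => ?_
      obtain ⟨haA, h2, h3, h4, h5, h6⟩ := ha
      have h7 : a ∉ l₀ := by
        intro h
        have := (h₀.hit_side hR hA hσ h h2).2
        linarith
      have h8 : a ∈ l := by
        by_contra h
        have := hW.at_end.side hσ haA
          (fun h' => (List.mem_append.mp h').elim h h7) h2
        linarith
      have h9 := (hW.at_end.hit_side hR hA hσ (List.mem_append_left _ h8) h2).1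
      have h10 := speedBin_bounds hδ (hspeed a h8).1.le
      rw [h9, neg_neg] at h3 h4
      refine Finset.mem_filter.mpr
        ⟨Finset.mem_filter.mpr ⟨List.mem_toFinset.mpr h8, h2⟩, ?_⟩
      apply le_antisymm
      · have h11 : (speedBin vmin δ |a.2| : ℝ) < (i + 1 : ℕ) := by
          by_contra hcon
          push Not at hcon
          nlinarith
        have : speedBin vmin δ |a.2| < i + 1 := by exact_mod_cast h11
        omega
      · have h11 : (i : ℝ) < (speedBin vmin δ |a.2| + 1 : ℕ) := by
          by_contra hcon
          push Not at hcon
          nlinarith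
        have : i < speedBin vmin δ |a.2| + 1 := by exact_mod_cast h11
        omega
  have : kick m M * (l.map fun a => σ * a.2 - c).sum ≤ 0 :=
    mul_nonpos_of_nonneg_of_nonpos (kick_pos hR.m_pos hR.M_pos).le (by rw [hsum]; linarith)
  linarith

end

/-! ### The piston stays slow -/

/-- The atoms that in free motion are at the time `t` within the distance `r` of `p`. -/
def nearby (p r t : ℝ) : Set (ℝ × ℝ) := {a | |a.1 + a.2 * t - p| ≤ r}

section

variable {m M b V₀ vmin vmax : ℝ} {A : Set (ℝ × ℝ)}

theorem HistoryAt.init (hV : |V₀| ≤ b) : HistoryAt m M b V₀ A 0 (initState V₀ A) [] where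
  history := History.init hV
  time_le := le_rfl
  quiet := by
    intro a _ τ hm
    have := hm.1
    simpa [initState] using this

/-- If only few atoms can reach the piston before the time `T`, the piston stays slow. -/
theorem coincide_of_few (hR : SlowRegime m M b vmin) (hA : RegularGas m M V₀ vmin vmax A)
    (hv : vmin < vmax) (hV : |V₀| ≤ b / 2) {T : ℝ} {N : ℕ}
    (hN : kick m M * (2 * vmax) * N ≤ b / 2) (hcount : CountLE A (nearby 0 (2 * vmax * T) 0) N) :
    VelocitiesCoincide m M b V₀ A T := by
  intro t ht
  obtain ⟨F, hF, hcard⟩ := hcount.exists_finset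
  have hb := hR.b_pos
  have h₀ : HistoryAt m M b V₀ A 0 (initState V₀ A) [] := HistoryAt.init (by linarith)
  obtain ⟨s, l, hW⟩ := h₀.exists_window (t := t) (t₁ := T) hR hA hv (w := b / 2) (by linarith)
    (by simp only [initState]; linarith) F (by exact_mod_cast hcard) hN
    (fun a ha hnear => by
      rw [← Finset.mem_coe, hF]
      refine ⟨ha, ?_⟩
      simpa [nearby, State.posAt, initState] using hnear) ht.1.le ht.2.le
  exact hW.at_end.velocities

/-- If in all windows of length `τ` the numbers of atoms that cross short intervals are close to
their means, the piston stays slow. -/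
theorem exists_historyAt_of_counts (hR : SlowRegime m M b vmin)
    (hA : RegularGas m M V₀ vmin vmax A) (hv : vmin < vmax) (hV : |V₀| ≤ b / 2) {τ h δ : ℝ}
    {K N n : ℕ} {upL loL upR loR : ℕ → ℝ} (hτ : 0 < τ) (hδ : 0 < δ) (hK : vmin + K * δ = vmax)
    (hN : kick m M * (2 * vmax) * N ≤ b / 8)
    (hcount : ∀ k < n, ∀ x : ℝ, |x| ≤ b * (k * τ) →
      (∃ p ≤ x, x < p + h ∧ CountLE A (nearby p (2 * vmax * τ + h) (k * τ)) N ∧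
        CountsBetween A vmin δ h (k * τ) ((k + 1 : ℕ) * τ) K upR loR 1 p) ∧
      ∃ p ≤ -x, -x < p + h ∧
        CountsBetween A vmin δ h (k * τ) ((k + 1 : ℕ) * τ) K upL loL (-1) p)
    (hbalL : ∑ i ∈ Finset.range K, (vmin + (i + 1 : ℕ) * δ - b / 8) * upL i
      ≤ ∑ i ∈ Finset.range K, (vmin + i * δ + b / 8) * loR i)
    (hbalR : ∑ i ∈ Finset.range K, (vmin + (i + 1 : ℕ) * δ - b / 8) * upR i
      ≤ ∑ i ∈ Finset.range K, (vmin + i * δ + b / 8) * loL i) :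
    ∀ k ≤ n, (∃ s l, HistoryAt m M b V₀ A (k * τ) s l ∧ |s.vel| ≤ b / 2 ∧
        |s.posAt (k * τ)| ≤ b * (k * τ)) ∧
      ∀ t, 0 ≤ t → t ≤ k * τ → ∃ s l, HistoryAt m M b V₀ A t s l := by
  have hb := hR.b_pos
  have hbv : b / 8 ≤ vmin := by linarith [hR.b_lt_vmin]
  intro k
  induction k with
  | zero =>
    intro _
    have h₀ : HistoryAt m M b V₀ A 0 (initState V₀ A) [] := HistoryAt.init (by linarith)
    refine ⟨⟨initState V₀ A, [], by simpa using h₀, hV, by simp [State.posAt, initState]⟩, ?_⟩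
    intro t ht ht'
    simp only [CharP.cast_eq_zero, zero_mul] at ht'
    obtain rfl : t = 0 := le_antisymm ht' ht
    exact ⟨_, _, h₀⟩
  | succ k ih =>
    intro hk
    obtain ⟨⟨s₀, l₀, h₀, hs₀, hx₀⟩, hprev⟩ := ih (by omega)
    obtain ⟨⟨p, hp, hph, hnear, hcR⟩, p', hp', hph', hcL⟩ := hcount k (by omega) _ hx₀
    obtain ⟨F, hF, hcard⟩ := hnear.exists_finset
    have hlen : ((k + 1 : ℕ) : ℝ) * τ - k * τ = τ := by push_cast; ring
    have hle : (k : ℝ) * τ ≤ (k + 1 : ℕ) * τ := by linarith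
    have hwin : ∀ t, k * τ ≤ t → t ≤ (k + 1 : ℕ) * τ →
        ∃ s l, Window m M b V₀ vmax (b / 8) A (k * τ) s₀ l₀ t s l := by
      intro t ht ht'
      refine h₀.exists_window hR hA hv (by linarith) (by linarith) F (by exact_mod_cast hcard) hN
        (fun a ha hnear => ?_) ht ht'
      rw [← Finset.mem_coe, hF]
      refine ⟨ha, ?_⟩
      rw [hlen] at hnear
      show |a.1 + a.2 * (k * τ) - p| ≤ _
      have h1 := abs_le.mp hnear
      rw [abs_le]
      constructor <;> linarith
    refine ⟨?_, ?_⟩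
    · obtain ⟨s, l, hW⟩ := hwin _ hle le_rfl
      obtain ⟨hw1, hw2⟩ := abs_le.mp hW.vel_sub_le
      obtain ⟨hv1, hv2⟩ := abs_le.mp hs₀
      obtain ⟨hx1, hx2⟩ := abs_le.mp hx₀
      refine ⟨s, l ++ l₀, hW.at_end, ?_, ?_⟩
      -- With `c = w = b / 8`: from a speed of at least `b / 4` the drag prevents growth, and from
      -- below `b / 4` one window leads at most to `3 * b / 8`.
      · rw [abs_le]
        constructor
        · by_cases hsmall : s₀.vel ≤ -(b / 4)
          · have := hW.slow_down h₀ hR hA (σ := -1) (Or.inr rfl) hle (c := b / 8) (by linarith)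
              hbv hδ hK (by linarith) (p := p) (p' := p') (h := h) (by linarith) (by linarith)
              (by linarith) (by linarith) (by rw [neg_neg]; exact hcR) hcL hbalR
            linarith
          · linarith
        · by_cases hsmall : b / 4 ≤ s₀.vel
          · have := hW.slow_down h₀ hR hA (σ := 1) (Or.inl rfl) hle (c := b / 8) (by linarith)
              hbv hδ hK (by linarith) (p := p') (p' := p) (h := h) (by linarith) (by linarith)
              (by linarith) (by linarith) hcL hcR hbalL
            linarith
          · linarith
      · have h1 := hW.pos_ge (-b) (by linarith)
        have h2 := hW.pos_le b (by linarith)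
        rw [hlen] at h1 h2
        have e : b * (((k + 1 : ℕ) : ℝ) * τ) = b * (k * τ) + b * τ := by push_cast; ring
        rw [e, abs_le]
        constructor <;> linarith
    · intro t ht ht'
      rcases le_total t (k * τ) with h1 | h1
      · exact hprev t ht h1
      · obtain ⟨s, l, hW⟩ := hwin t h1 ht'
        exact ⟨s, l ++ l₀, hW.at_end⟩

end

/-! ### Poisson processes -/

section

variable {Ω E : Type*} [MeasurableSpace Ω] [MeasurableSpace E] {μ : Measure Ω} {Λ : Measure E}
  {S : Ω → Set E}

theorem IsPoissonProcess.measure_count (h : IsPoissonProcess μ Λ S) {D : Set E}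
    (hD : MeasurableSet D) (hΛ : Λ D ≠ ∞) (B : Set ℕ∞) :
    μ {ω | (S ω ∩ D).encard ∈ B}
      = poissonMeasure (Λ D).toNNReal {k : ℕ | (k : ℕ∞) ∈ B} := by
  have h1 := congrArg (fun ν : Measure ℕ∞ => ν B) (h.map_count D hD hΛ)
  rw [Measure.map_apply (h.measurable_count D hD) (MeasurableSet.of_discrete),
    Measure.map_apply (by exact measurable_from_top) MeasurableSet.of_discrete] at h1
  exact h1

theorem poissonMeasure_ne_zero_le (r : ℝ≥0) : poissonMeasure r {k : ℕ | (k : ℕ∞) ∈ ({0}ᶜ : Set ℕ∞)}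
    ≤ r := by
  have e : {k : ℕ | (k : ℕ∞) ∈ ({0}ᶜ : Set ℕ∞)} = ({0} : Set ℕ)ᶜ := by ext k; simp
  rw [e, prob_compl_eq_one_sub (measurableSet_singleton 0), poissonMeasure_singleton]
  simp only [pow_zero, mul_one, Nat.factorial_zero, Nat.cast_one, div_one]
  rw [← ENNReal.ofReal_one, ← ENNReal.ofReal_sub _ (Real.exp_pos _).le,
    ENNReal.ofReal_le_iff_le_toReal (by simp)]
  have := Real.add_one_le_exp (-(r : ℝ))
  simp only [ENNReal.coe_toReal]
  linarith

theorem IsPoissonProcess.measure_nonempty_le (h : IsPoissonProcess μ Λ S) {D : Set E}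
    (hD : MeasurableSet D) : μ {ω | (S ω ∩ D).encard ∈ ({0}ᶜ : Set ℕ∞)} ≤ Λ D := by
  by_cases hΛ : Λ D = ∞
  · rw [hΛ]; exact le_top
  · rw [h.measure_count hD hΛ]
    refine (poissonMeasure_ne_zero_le _).trans ?_
    rw [ENNReal.coe_toNNReal hΛ]

theorem IsPoissonProcess.ae_inter_eq_empty (h : IsPoissonProcess μ Λ S) {D : Set E}
    (hD : MeasurableSet D) (h0 : Λ D = 0) : ∀ᵐ ω ∂μ, S ω ∩ D = ∅ := by
  rw [ae_iff]
  have := h.measure_nonempty_le hD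
  rw [h0, nonpos_iff_eq_zero] at this
  simpa [Set.encard_eq_zero] using this

theorem IsPoissonProcess.ae_finite (h : IsPoissonProcess μ Λ S) {D : Set E}
    (hD : MeasurableSet D) (hΛ : Λ D ≠ ∞) : ∀ᵐ ω ∂μ, (S ω ∩ D).Finite := by
  rw [ae_iff]
  have := h.measure_count hD hΛ {⊤}
  simpa [Set.encard_eq_top_iff] using this

/-- The points of a Poisson process avoid a box of disjoint sets with the expected probability. -/
theorem IsPoissonProcess.measure_box_le (h : IsPoissonProcess μ Λ S) {k : ℕ} {D : Fin k → Set E}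
    (hD : ∀ i, MeasurableSet (D i)) (hdisj : Pairwise fun i j => Disjoint (D i) (D j)) :
    μ {ω | ∃ z : Fin k → E, (∀ i, z i ∈ S ω) ∧ ∀ i, z i ∈ D i} ≤ ∏ i, Λ (D i) := by
  have h1 := (h.indep_count k D hD hdisj).measure_inter_preimage_eq_mul Finset.univ
    (sets := fun _ => ({0}ᶜ : Set ℕ∞)) (fun _ _ => trivial)
  calc μ {ω | ∃ z : Fin k → E, (∀ i, z i ∈ S ω) ∧ ∀ i, z i ∈ D i}
      ≤ μ (⋂ i ∈ (Finset.univ : Finset (Fin k)),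
          (fun ω => (S ω ∩ D i).encard) ⁻¹' ({0}ᶜ : Set ℕ∞)) := by
        refine measure_mono ?_
        rintro ω ⟨z, hz, hzD⟩
        simp only [Finset.mem_univ, iInter_true, mem_iInter, mem_preimage, mem_compl_iff,
          mem_singleton_iff, Set.encard_eq_zero]
        intro i hi
        exact (hi ▸ (⟨hz i, hzD i⟩ : z i ∈ S ω ∩ D i) : z i ∈ (∅ : Set E))
    _ = ∏ i, μ ((fun ω => (S ω ∩ D i).encard) ⁻¹' ({0}ᶜ : Set ℕ∞)) := h1
    _ ≤ ∏ i, Λ (D i) := Finset.prod_le_prod' fun i _ => h.measure_nonempty_le (hD i)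

/-- The product measure comes from the outer measure generated by boxes, so a null set has countable
covers whose total product mass is arbitrarily small. -/
theorem exists_box_cover {k : ℕ} [SigmaFinite Λ] {N : Set (Fin (k + 1) → E)}
    (hN : Measure.pi (fun _ : Fin (k + 1) => Λ) N = 0) {r : ℝ≥0∞} (hr : r ≠ 0) :
    ∃ D : ℕ → Fin (k + 1) → Set E, (∀ n i, MeasurableSet (D n i)) ∧
      N ⊆ ⋃ n, Set.pi univ (D n) ∧ ∑' n, ∏ i, Λ (D n i) < r := by
  let m : Fin (k + 1) → OuterMeasure E := fun _ => Λ.toOuterMeasure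
  have h0 : OuterMeasure.pi m (toMeasurable (Measure.pi fun _ : Fin (k + 1) => Λ) N) = 0 := by
    rw [← measure_toMeasurable N, Measure.pi,
      toMeasure_apply _ _ (by
        rw [← Measure.pi]; exact measurableSet_toMeasurable _ _)] at hN
    rw [Measure.pi]
    exact hN
  -- This needs a nonempty index type, hence `k + 1`: an empty product would be `1`.
  have hempty : piPremeasure m ∅ = 0 := by
    unfold piPremeasure
    refine Finset.prod_eq_zero (Finset.mem_univ 0) ?_
    simp
  rw [OuterMeasure.pi, OuterMeasure.boundedBy_eq_ofFunction hempty,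
    OuterMeasure.ofFunction_apply] at h0
  have h1 := h0 ▸ pos_iff_ne_zero.mpr hr
  simp only [iInf_lt_iff] at h1
  obtain ⟨t, ht, hsum⟩ := h1
  refine ⟨fun n i => toMeasurable Λ (Function.eval i '' t n),
    fun n i => measurableSet_toMeasurable _ _, ?_, ?_⟩
  · refine (subset_toMeasurable _ _).trans (ht.trans (iUnion_mono fun n z hz i _ => ?_))
    exact subset_toMeasurable _ _ ⟨z, hz, rfl⟩
  · simp only [measure_toMeasurable]
    exact hsum

/-- Almost surely no tuple of distinct points of a Poisson process is in a null set. -/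
theorem IsPoissonProcess.ae_forall_tuple_notMem [TopologicalSpace E] [T2Space E]
    [SecondCountableTopology E] [BorelSpace E] [SigmaFinite Λ] (h : IsPoissonProcess μ Λ S) {k : ℕ}
    {N : Set (Fin (k + 1) → E)} (hN : Measure.pi (fun _ : Fin (k + 1) => Λ) N = 0) :
    ∀ᵐ ω ∂μ, ∀ z : Fin (k + 1) → E, (∀ i, z i ∈ S ω) → Function.Injective z → z ∉ N := by
  have key : ∀ U : Fin (k + 1) → Set E, (∀ i, MeasurableSet (U i)) →
      (Pairwise fun i j => Disjoint (U i) (U j)) →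
      ∀ᵐ ω ∂μ, ∀ z : Fin (k + 1) → E, (∀ i, z i ∈ S ω) → (∀ i, z i ∈ U i) → z ∉ N := by
    intro U hU hdisj
    rw [ae_iff]
    -- The cover is taken with total mass below the supposedly positive measure of the exceptional
    -- event. Intersected with the disjoint `U i` its boxes have disjoint sides, and independence
    -- gives the product bound.
    by_contra hne
    obtain ⟨D, hD, hcov, hsum⟩ := exists_box_cover hN hne
    refine absurd hsum (not_lt.mpr ?_)
    calc _ ≤ μ (⋃ n, {ω | ∃ z : Fin (k + 1) → E, (∀ i, z i ∈ S ω) ∧ ∀ i, z i ∈ D n i ∩ U i}) := by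
          refine measure_mono ?_
          intro ω hω
          simp only [mem_ofPred_eq, not_forall, not_not] at hω
          obtain ⟨z, hz, hzU, hzN⟩ := hω
          obtain ⟨n, hn⟩ := mem_iUnion.mp (hcov hzN)
          exact mem_iUnion.mpr ⟨n, z, hz, fun i => ⟨hn i (mem_univ i), hzU i⟩⟩
      _ ≤ ∑' n, μ {ω | ∃ z : Fin (k + 1) → E, (∀ i, z i ∈ S ω) ∧ ∀ i, z i ∈ D n i ∩ U i} :=
          measure_iUnion_le _
      _ ≤ ∑' n, ∏ i, Λ (D n i) := by
          refine ENNReal.tsum_le_tsum fun n => ?_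
          refine (h.measure_box_le (fun i => (hD n i).inter (hU i)) fun i j hij =>
            (hdisj hij).mono inter_subset_right inter_subset_right).trans ?_
          exact Finset.prod_le_prod' fun i _ => measure_mono inter_subset_left
  let B := TopologicalSpace.countableBasis E
  have hB : TopologicalSpace.IsTopologicalBasis B := TopologicalSpace.isBasis_countableBasis E
  have : Countable B := (TopologicalSpace.countable_countableBasis E).to_subtype
  have hall : ∀ᵐ ω ∂μ, ∀ U : Fin (k + 1) → B, (Pairwise fun i j => Disjoint (U i : Set E) (U j)) →
      ∀ z : Fin (k + 1) → E, (∀ i, z i ∈ S ω) → (∀ i, z i ∈ (U i : Set E)) → z ∉ N := by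
    rw [ae_all_iff]
    intro U
    by_cases hU : Pairwise fun i j => Disjoint (U i : Set E) (U j)
    · filter_upwards [key (fun i => U i) (fun i => (hB.isOpen (U i).2).measurableSet) hU] with ω hω _
      exact hω
    · exact Filter.Eventually.of_forall fun ω h => absurd h hU
  filter_upwards [hall] with ω hω z hz hinj
  -- Distinct points are separated by disjoint sets of a countable basis, so countably many families
  -- `U` suffice.
  obtain ⟨O, hO, hOd⟩ := (Set.finite_range z).t2_separation
  choose U hU using fun i => hB.exists_subset_of_mem_open (hO (z i)).1 (hO (z i)).2
  refine hω (fun i => ⟨U i, (hU i).1⟩) (fun i j hij => ?_) z hz fun i => (hU i).2.1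
  exact (hOd (mem_range_self i) (mem_range_self j) (hinj.ne hij)).mono (hU i).2.2 (hU j).2.2

end

/-! ### The gas is almost surely regular -/

theorem measurable_meetTime : Measurable fun q : (ℝ × ℝ) × (ℝ × ℝ) => meetTime q.1 q.2 := by
  unfold meetTime; fun_prop

theorem measurable_pistonLine (m M V₀ : ℝ) (n : ℕ) :
    Measurable fun z : Fin n → ℝ × ℝ => pistonLine m M V₀ (List.ofFn z) := by
  induction n with
  | zero => simp only [List.ofFn_zero]; exact measurable_const
  | succ n ih =>
    simp only [List.ofFn_succ, pistonLine]
    have h1 : Measurable fun z : Fin (n + 1) → ℝ × ℝ =>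
        pistonLine m M V₀ (List.ofFn fun i => z i.succ) :=
      ih.comp (measurable_pi_lambda _ fun i => measurable_pi_apply _)
    have h2 : Measurable fun z : Fin (n + 1) → ℝ × ℝ => z 0 := measurable_pi_apply 0
    have h3 : Measurable fun z : Fin (n + 1) → ℝ × ℝ =>
        meetTime (pistonLine m M V₀ (List.ofFn fun i => z i.succ)) (z 0) :=
      measurable_meetTime.comp (h1.prodMk h2)
    unfold pistonAfter
    exact Measurable.prodMk (by fun_prop) (by fun_prop)

theorem volume_line_eq_zero (t y : ℝ) : volume {b : ℝ × ℝ | b.1 + b.2 * t = y} = 0 := by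
  have hm : MeasurableSet {b : ℝ × ℝ | b.1 + b.2 * t = y} :=
    measurableSet_eq_fun (by fun_prop) (by fun_prop)
  rw [Measure.volume_eq_prod, Measure.prod_apply_symm hm]
  have : ∀ v : ℝ, volume ((fun x => (x, v)) ⁻¹' {b : ℝ × ℝ | b.1 + b.2 * t = y}) = 0 := by
    intro v
    have e : (fun x => (x, v)) ⁻¹' {b : ℝ × ℝ | b.1 + b.2 * t = y} = {y - v * t} := by
      ext x
      simp only [mem_preimage, mem_ofPred_eq, mem_singleton_iff]
      constructor <;> intro h <;> linarith
    rw [e, Real.volume_singleton]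
  rw [lintegral_congr this, lintegral_zero]

/-- By Fubini: with the other atoms fixed, the equation confines the first atom to a line, which is
a null set. Genericity is of this type, as `pistonLine` depends measurably on the other atoms only.
-/
theorem pi_line_eq_zero {Λ : Measure (ℝ × ℝ)} [SigmaFinite Λ] (hΛ : Λ ≪ volume) {n : ℕ}
    {T Y : (Fin n → ℝ × ℝ) → ℝ} (hT : Measurable T) (hY : Measurable Y) :
    Measure.pi (fun _ : Fin (n + 1) => Λ)
      {z | (z 0).1 + (z 0).2 * T (fun i => z i.succ) = Y (fun i => z i.succ)} = 0 := by
  have hm : MeasurableSet {q : (ℝ × ℝ) × (Fin n → ℝ × ℝ) | q.1.1 + q.1.2 * T q.2 = Y q.2} :=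
    measurableSet_eq_fun (by fun_prop) (by fun_prop)
  have h1 := measurePreserving_piFinSuccAbove (fun _ : Fin (n + 1) => Λ) 0
  have h2 := h1.measure_preimage hm.nullMeasurableSet
  have e : (MeasurableEquiv.piFinSuccAbove (fun _ : Fin (n + 1) => ℝ × ℝ) 0) ⁻¹'
      {q : (ℝ × ℝ) × (Fin n → ℝ × ℝ) | q.1.1 + q.1.2 * T q.2 = Y q.2}
      = {z | (z 0).1 + (z 0).2 * T (fun i => z i.succ) = Y (fun i => z i.succ)} := rfl
  rw [e] at h2
  rw [h2, Measure.prod_apply_symm hm]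
  have : ∀ w : Fin n → ℝ × ℝ, Λ ((fun x => (x, w)) ⁻¹'
      {q : (ℝ × ℝ) × (Fin n → ℝ × ℝ) | q.1.1 + q.1.2 * T q.2 = Y q.2}) = 0 := fun w =>
    hΛ (volume_line_eq_zero (T w) (Y w))
  rw [lintegral_congr this, lintegral_zero]

section

variable {Ω : Type*} [MeasurableSpace Ω] {μ : Measure Ω} {Λ : Measure (ℝ × ℝ)}
  {S : Ω → Set (ℝ × ℝ)}

/-- Almost surely no two atoms meet the piston simultaneously. -/
theorem IsPoissonProcess.ae_generic [SigmaFinite Λ] (h : IsPoissonProcess μ Λ S)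
    (hΛ : Λ ≪ volume) (m M V₀ : ℝ) :
    ∀ᵐ ω ∂μ, ∀ (l : List (ℝ × ℝ)) (a c : ℝ × ℝ), (c :: a :: l).Nodup →
      (∀ x ∈ c :: a :: l, x ∈ S ω) →
      c.1 + c.2 * meetTime (pistonLine m M V₀ l) a
        ≠ a.1 + a.2 * meetTime (pistonLine m M V₀ l) a := by
  let T : ∀ n : ℕ, (Fin (n + 1) → ℝ × ℝ) → ℝ := fun n w =>
    meetTime (pistonLine m M V₀ (List.ofFn fun i => w i.succ)) (w 0)
  have hT : ∀ n, Measurable (T n) := fun n =>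
    measurable_meetTime.comp (((measurable_pistonLine m M V₀ n).comp
      (measurable_pi_lambda _ fun i => measurable_pi_apply _)).prodMk (measurable_pi_apply 0))
  have hall : ∀ᵐ ω ∂μ, ∀ n : ℕ, ∀ z : Fin (n + 2) → ℝ × ℝ, (∀ i, z i ∈ S ω) →
      Function.Injective z → z ∉ {z : Fin (n + 2) → ℝ × ℝ | (z 0).1
        + (z 0).2 * T n (fun i => z i.succ) = (z 1).1 + (z 1).2 * T n (fun i => z i.succ)} := by
    rw [ae_all_iff]
    intro n
    refine h.ae_forall_tuple_notMem (pi_line_eq_zero hΛ (hT n)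
      (Y := fun w => (w 0).1 + (w 0).2 * T n w) ?_)
    have := hT n
    fun_prop
  filter_upwards [hall] with ω hω l a c hnodup hmem heq
  refine hω l.length (c :: a :: l).get (fun i => hmem _ (List.get_mem (c :: a :: l) i))
    (List.nodup_iff_injective_get.mp hnodup) ?_
  have e : (List.ofFn fun i : Fin l.length => (c :: a :: l).get i.succ.succ) = l := List.ofFn_get l
  show c.1 + c.2 * meetTime (pistonLine m M V₀ (List.ofFn fun i : Fin l.length =>
      (c :: a :: l).get i.succ.succ)) a = a.1 + a.2 * meetTime (pistonLine m M V₀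
      (List.ofFn fun i : Fin l.length => (c :: a :: l).get i.succ.succ)) a
  rw [e]
  exact heq

end

/-! ### Tails of the Poisson distribution -/

/-- The exponential Chebyshev inequality for the Poisson distribution. -/
theorem poissonMeasure_le_exp (r : ℝ≥0) {s c : ℝ} {B : Set ℕ}
    (hB : ∀ k ∈ B, 0 ≤ c + s * k) :
    poissonMeasure r B ≤ ENNReal.ofReal (Real.exp (c + r * (Real.exp s - 1))) := by
  have hsum : HasSum (fun n : ℕ => Real.exp (-r) * (r : ℝ) ^ n / (n.factorial : ℝ)
      * Real.exp (c + s * n)) (Real.exp (c + r * (Real.exp s - 1))) := by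
    have h1 := (NormedSpace.expSeries_div_hasSum_exp ((r : ℝ) * Real.exp s)).mul_left
      (Real.exp (c - r))
    rw [← Real.exp_eq_exp_ℝ, ← Real.exp_add] at h1
    have e1 : ∀ n : ℕ, Real.exp (-r) * (r : ℝ) ^ n / (n.factorial : ℝ) * Real.exp (c + s * n)
        = Real.exp (c - r) * (((r : ℝ) * Real.exp s) ^ n / (n.factorial : ℝ)) := fun n => by
      rw [mul_pow, ← Real.exp_nat_mul, Real.exp_add, sub_eq_add_neg, Real.exp_add, mul_comm s]
      ring
    have e2 : c + r * (Real.exp s - 1) = c - r + r * Real.exp s := by ring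
    rw [e2]
    simp_rw [e1]
    exact h1
  rw [← hsum.tsum_eq, ENNReal.ofReal_tsum_of_nonneg (fun n => by positivity) hsum.summable,
    poissonMeasure, Measure.sum_apply _ MeasurableSet.of_discrete]
  refine ENNReal.tsum_le_tsum fun n => ?_
  rw [Measure.smul_apply, smul_eq_mul, ENNReal.ofReal_mul (by positivity)]
  gcongr
  rw [Measure.dirac_apply' _ MeasurableSet.of_discrete]
  by_cases hn : n ∈ B
  · rw [Set.indicator_of_mem hn, Pi.one_apply, ENNReal.one_le_ofReal]
    exact Real.one_le_exp (hB n hn)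
  · rw [Set.indicator_of_notMem hn]; exact zero_le

theorem exp_sub_one_le_add_sq {s : ℝ} (hs : |s| ≤ 1) : Real.exp s - 1 ≤ s + s ^ 2 := by
  have := Real.abs_exp_sub_one_sub_id_le hs
  linarith [le_abs_self (Real.exp s - 1 - s)]

section

variable {Ω : Type*} [MeasurableSpace Ω] {μ : Measure Ω} {Λ : Measure (ℝ × ℝ)}
  {S : Ω → Set (ℝ × ℝ)}

/-- Chernoff's bound with a free parameter `s`; the mean may be replaced by any upper bound `L`
because `exp s - 1` is nonnegative. -/
theorem measure_not_countLE_le (h : IsPoissonProcess μ Λ S) {D : Set (ℝ × ℝ)}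
    (hD : MeasurableSet D) {L r s : ℝ} (hL : 0 ≤ L) (hΛ : Λ D ≤ ENNReal.ofReal L) (hs : 0 ≤ s) :
    μ {ω | ¬ CountLE (S ω) D r} ≤ ENNReal.ofReal (Real.exp (L * (Real.exp s - 1) - s * r)) := by
  have hfin : Λ D ≠ ∞ := ne_top_of_le_ne_top ENNReal.ofReal_ne_top hΛ
  have h1 := h.measure_count hD hfin {e : ℕ∞ | ¬ ∃ n : ℕ, e = n ∧ (n : ℝ) ≤ r}
  refine (le_of_eq h1).trans ((poissonMeasure_le_exp (c := -(s * r)) (s := s) _ ?_).trans ?_)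
  · intro k hk
    have : ¬ (k : ℝ) ≤ r := fun h' => hk ⟨k, rfl, h'⟩
    nlinarith
  · apply ENNReal.ofReal_le_ofReal
    rw [Real.exp_le_exp]
    have h2 : ((Λ D).toNNReal : ℝ) ≤ L := ENNReal.toReal_le_of_le_ofReal hL hΛ
    have h3 : 0 ≤ Real.exp s - 1 := by linarith [Real.one_le_exp hs]
    nlinarith

/-- A Poisson number exceeds its mean by `a` with an exponentially small probability. -/
theorem measure_not_countLE_add_le (h : IsPoissonProcess μ Λ S) {D : Set (ℝ × ℝ)}
    (hD : MeasurableSet D) {L a s : ℝ} (hL : 0 ≤ L) (hΛ : Λ D ≤ ENNReal.ofReal L) (hs : 0 ≤ s)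
    (hs1 : s ≤ 1) (hsa : 2 * (L * s) ≤ a) :
    μ {ω | ¬ CountLE (S ω) D (L + a)} ≤ ENNReal.ofReal (Real.exp (-(s * a / 2))) := by
  refine (measure_not_countLE_le h hD hL hΛ hs).trans (ENNReal.ofReal_le_ofReal ?_)
  rw [Real.exp_le_exp]
  have h1 := exp_sub_one_le_add_sq (by rwa [abs_of_nonneg hs] : |s| ≤ 1)
  have h2 := mul_le_mul_of_nonneg_left h1 hL
  have h3 := mul_le_mul_of_nonneg_left hsa hs
  nlinarith

/-- A Poisson number is below its mean by `a` with an exponentially small probability. -/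
theorem measure_not_countGE_sub_le (h : IsPoissonProcess μ Λ S) {D : Set (ℝ × ℝ)}
    (hD : MeasurableSet D) (hfin : Λ D ≠ ∞) {L L' a s : ℝ} (hL : 0 ≤ L')
    (hΛ' : ENNReal.ofReal L ≤ Λ D) (hΛ : Λ D ≤ ENNReal.ofReal L') (hs : 0 ≤ s)
    (hs1 : s ≤ 1) (hsa : 2 * (L' * s) ≤ a) :
    μ {ω | ¬ CountGE (S ω) D (L - a)} ≤ ENNReal.ofReal (Real.exp (-(s * a / 2))) := by
  have h1 := h.measure_count hD hfin {e : ℕ∞ | ¬ ∀ n : ℕ, e = n → L - a ≤ (n : ℝ)}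
  refine (le_of_eq h1).trans ((poissonMeasure_le_exp (c := s * (L - a)) (s := -s) _ ?_).trans ?_)
  · intro k hk
    have : ¬ L - a ≤ (k : ℝ) := fun h' => hk fun n hn => by
      have : k = n := by exact_mod_cast hn
      rwa [← this]
    nlinarith
  · apply ENNReal.ofReal_le_ofReal
    rw [Real.exp_le_exp]
    have h2 : ((Λ D).toNNReal : ℝ) ≤ L' := ENNReal.toReal_le_of_le_ofReal hL hΛ
    have h2' : L ≤ ((Λ D).toNNReal : ℝ) := by
      have := (ENNReal.ofReal_le_iff_le_toReal hfin).mp hΛ'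
      exact this
    have h3 := exp_sub_one_le_add_sq (by rwa [abs_neg, abs_of_nonneg hs] : |-s| ≤ 1)
    have h4 := mul_le_mul_of_nonneg_left h3 ((Λ D).toNNReal).coe_nonneg
    have h5 := mul_le_mul_of_nonneg_left hsa hs
    have h6 := mul_le_mul_of_nonneg_left h2' hs
    have h7 := mul_le_mul_of_nonneg_left h2 (mul_nonneg hs hs)
    nlinarith

/-- Few points in sets of intensity proportional to a small `T`. -/
theorem measure_not_countLE_le_sq (h : IsPoissonProcess μ Λ S) {D : Set (ℝ × ℝ)}
    (hD : MeasurableSet D) {C T : ℝ} {N : ℕ} (hC : 0 ≤ C) (hT : 0 < T) (hT1 : T ≤ 1)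
    (hΛ : Λ D ≤ ENNReal.ofReal (C * T)) (hN : 2 ≤ N) :
    μ {ω | ¬ CountLE (S ω) D N}
      ≤ ENNReal.ofReal (T ^ 2 * Real.exp (C * Real.exp 1 - N)) := by
  have hlog : Real.log T ≤ 0 := Real.log_nonpos hT.le hT1
  -- The choice `s = 1 - log T` makes `exp s = e / T`, which cancels the `T` in the mean, while `-s
  -- * N` contributes `N * log T ≤ 2 * log T`, that is, the factor `T ^ 2`.
  refine (measure_not_countLE_le h hD (by positivity) hΛ
    (s := 1 - Real.log T) (by linarith)).trans (ENNReal.ofReal_le_ofReal ?_)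
  have e : T ^ 2 = Real.exp (2 * Real.log T) := by
    rw [← Nat.cast_ofNat (R := ℝ), Real.exp_nat_mul, Real.exp_log hT]
  rw [e, ← Real.exp_add, Real.exp_le_exp, Real.exp_sub, Real.exp_log hT]
  have hN' : (2 : ℝ) ≤ N := by exact_mod_cast hN
  have e2 : C * T * (Real.exp 1 / T - 1) = C * Real.exp 1 - C * T := by field_simp
  rw [e2]
  nlinarith [mul_nonneg hC hT.le]

end

/-! ### The intensity of the gas -/

section

variable {nL nR : ℝ} {fL fR : ℝ → ℝ}

theorem measurable_gasDensity (hfL : Measurable fL) (hfR : Measurable fR) :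
    Measurable (gasDensity nL nR fL fR) := by
  unfold gasDensity
  refine Measurable.ite (measurableSet_lt measurable_const measurable_fst) (by fun_prop) ?_
  exact Measurable.ite (measurableSet_lt measurable_fst measurable_const) (by fun_prop)
    measurable_const

instance : SigmaFinite (gasIntensity nL nR fL fR) := by
  unfold gasIntensity; infer_instance

theorem gasIntensity_absolutelyContinuous : gasIntensity nL nR fL fR ≪ volume :=
  withDensity_absolutelyContinuous _ _

theorem gasIntensity_apply (hfL : Measurable fL) (hfR : Measurable fR) {D : Set (ℝ × ℝ)}
    (hD : MeasurableSet D) : gasIntensity nL nR fL fR D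
      = ∫⁻ v, ∫⁻ x, D.indicator (fun z => ENNReal.ofReal (gasDensity nL nR fL fR z)) (x, v) := by
  unfold gasIntensity
  rw [withDensity_apply _ hD, ← lintegral_indicator hD, Measure.volume_eq_prod,
    lintegral_prod_symm _ (((measurable_gasDensity hfL hfR).ennreal_ofReal).indicator
      hD).aemeasurable]

/-- Fubini with the velocity outside: for every velocity the admissible positions lie in an interval
of length `len`, whose place may depend on the velocity. -/
theorem gasIntensity_le (hfL : Measurable fL) (hfR : Measurable fR) {D : Set (ℝ × ℝ)}
    (hD : MeasurableSet D) {V : Set ℝ} (hV : MeasurableSet V) {g y : ℝ → ℝ} {len : ℝ}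
    (h : ∀ z ∈ D, z.2 ∈ V ∧ z.1 ∈ Icc (y z.2) (y z.2 + len) ∧
      gasDensity nL nR fL fR z ≤ g z.2) :
    gasIntensity nL nR fL fR D ≤ ENNReal.ofReal len * ∫⁻ v in V, ENNReal.ofReal (g v) := by
  rw [gasIntensity_apply hfL hfR hD, ← lintegral_const_mul' _ _ ENNReal.ofReal_ne_top,
    ← lintegral_indicator hV]
  refine lintegral_mono fun v => ?_
  by_cases hv : v ∈ V
  · rw [indicator_of_mem hv]
    calc ∫⁻ x, D.indicator (fun z => ENNReal.ofReal (gasDensity nL nR fL fR z)) (x, v)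
        ≤ ∫⁻ x, (Icc (y v) (y v + len)).indicator (fun _ => ENNReal.ofReal (g v)) x := by
          refine lintegral_mono fun x => ?_
          by_cases hx : (x, v) ∈ D
          · obtain ⟨-, h2, h3⟩ := h _ hx
            rw [indicator_of_mem hx, indicator_of_mem h2]
            exact ENNReal.ofReal_le_ofReal h3
          · rw [indicator_of_notMem hx]; exact zero_le
      _ = _ := by
          rw [lintegral_indicator measurableSet_Icc, setLIntegral_const, Real.volume_Icc,
            add_sub_cancel_left, mul_comm]
  · rw [indicator_of_notMem hv]
    have : ∀ x, D.indicator (fun z => ENNReal.ofReal (gasDensity nL nR fL fR z)) (x, v) = 0 :=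
      fun x => indicator_of_notMem (fun hx => hv (h _ hx).1) _
    rw [lintegral_congr this, lintegral_zero]

theorem le_gasIntensity (hfL : Measurable fL) (hfR : Measurable fR) {D : Set (ℝ × ℝ)}
    (hD : MeasurableSet D) {V : Set ℝ} (hV : MeasurableSet V) {g y : ℝ → ℝ} {len : ℝ}
    (h : ∀ v ∈ V, ∀ x ∈ Icc (y v) (y v + len), (x, v) ∈ D ∧
      g v ≤ gasDensity nL nR fL fR (x, v)) :
    ENNReal.ofReal len * ∫⁻ v in V, ENNReal.ofReal (g v) ≤ gasIntensity nL nR fL fR D := by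
  rw [gasIntensity_apply hfL hfR hD, ← lintegral_const_mul' _ _ ENNReal.ofReal_ne_top,
    ← lintegral_indicator hV]
  refine lintegral_mono fun v => ?_
  by_cases hv : v ∈ V
  · rw [indicator_of_mem hv]
    calc _ = ∫⁻ x, (Icc (y v) (y v + len)).indicator (fun _ => ENNReal.ofReal (g v)) x := by
          rw [lintegral_indicator measurableSet_Icc, setLIntegral_const, Real.volume_Icc,
            add_sub_cancel_left, mul_comm]
      _ ≤ _ := by
          refine lintegral_mono fun x => ?_
          by_cases hx : x ∈ Icc (y v) (y v + len)
          · obtain ⟨h2, h3⟩ := h v hv x hx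
            rw [indicator_of_mem hx, indicator_of_mem h2]
            exact ENNReal.ofReal_le_ofReal h3
          · rw [indicator_of_notMem hx]; exact zero_le
  · rw [indicator_of_notMem hv]; exact zero_le

theorem measurableSet_crossing (σ lo hi t₀ t₁ u u' : ℝ) :
    MeasurableSet (crossing σ lo hi t₀ t₁ u u') := by
  unfold crossing
  measurability

theorem measurableSet_nearby (p r t : ℝ) : MeasurableSet (nearby p r t) :=
  measurableSet_le (by fun_prop) measurable_const

/-- The mass of a symmetric density on the velocities that point to the piston from the side `σ`,
with speed in a bin. -/
theorem lintegral_velocities {vmin vmax : ℝ} {f : ℝ → ℝ} (hf : IsCutoffDensity vmin vmax f) {n : ℝ}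
    (hn : 0 ≤ n) {σ : ℝ} (hσ : σ = 1 ∨ σ = -1) {u u' : ℝ} (hu : u ≤ u') :
    ∫⁻ v in {v | u ≤ -(σ * v) ∧ -(σ * v) < u'}, ENNReal.ofReal (n * f v)
      = ENNReal.ofReal (n * ∫ v in u..u', f v) := by
  have h1 : ∫⁻ v in Ico u u', ENNReal.ofReal (n * f v)
      = ENNReal.ofReal (n * ∫ v in u..u', f v) := by
    rw [← intervalIntegral.integral_const_mul, intervalIntegral.integral_of_le hu,
      ← ofReal_integral_eq_lintegral_ofReal ((hf.integrable.const_mul n).integrableOn)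
        (Filter.Eventually.of_forall fun v => mul_nonneg hn (hf.nonneg v)),
      integral_Ico_eq_integral_Ioo, integral_Ioc_eq_integral_Ioo]
  rcases hσ with rfl | rfl
  · rw [← h1, ← lintegral_indicator measurableSet_Ico, ← lintegral_indicator (by measurability)]
    refine Eq.trans (lintegral_congr fun v => ?_) (lintegral_neg_eq_self ..)
    simp only [indicator, mem_ofPred_eq, mem_Ico, one_mul, hf.symm]
  · rw [← h1]
    congr 2
    ext v
    simp

/-- Atoms of speed `s` that cross during the window start in an interval of length at most `s * (t₁
- t₀) + h`, and `s < u'`. -/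
theorem gasIntensity_crossing_le {vmin vmax : ℝ} (hfL : Measurable fL) (hfR : Measurable fR)
    {f : ℝ → ℝ} (hf : IsCutoffDensity vmin vmax f) {n σ : ℝ} (hn : 0 ≤ n)
    (hσ : σ = 1 ∨ σ = -1) (hdens : ∀ z : ℝ × ℝ, 0 < σ * z.1 → gasDensity nL nR fL fR z = n * f z.2)
    {p h t₀ t₁ u u' : ℝ} (ht : t₀ ≤ t₁) (hh : 0 ≤ h) (hu : 0 ≤ u) (huu : u ≤ u') :
    gasIntensity nL nR fL fR (crossing σ p (p + h) t₀ t₁ u u')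
      ≤ ENNReal.ofReal (n * (∫ v in u..u', f v) * (u' * (t₁ - t₀) + h)) := by
  have hm : 0 ≤ ∫ v in u..u', f v := intervalIntegral.integral_nonneg huu fun v _ => hf.nonneg v
  have hV : MeasurableSet {v | u ≤ -(σ * v) ∧ -(σ * v) < u'} := by measurability
  have hlen : 0 ≤ u' * (t₁ - t₀) + h :=
    add_nonneg (mul_nonneg (hu.trans huu) (by linarith)) hh
  -- Each interval has one end where the constraint at time `t₀` is sharp: the left end for `σ = 1`,
  -- the right end for `σ = -1`.
  refine (gasIntensity_le hfL hfR (measurableSet_crossing _ _ _ _ _ _ _) hV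
    (g := fun v => n * f v) (y := fun v => if σ = 1 then p - v * t₀ else
      -(p + h) - v * t₁ - (u' + v * σ) * (t₁ - t₀))
    (len := u' * (t₁ - t₀) + h) ?_).trans_eq ?_
  · rintro ⟨x, v⟩ ⟨h1, h2, h3, h4, h5⟩
    refine ⟨⟨h2, h3⟩, ?_, (hdens _ h1).le⟩
    have h6 : -(σ * v) * (t₁ - t₀) ≤ u' * (t₁ - t₀) :=
      mul_le_mul_of_nonneg_right h3.le (by linarith)
    simp only at h1 h2 h3 h4 h5
    rcases hσ with rfl | rfl
    · simp only [if_true, mem_Icc]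
      constructor <;> nlinarith
    · have hne : ¬ ((-1 : ℝ) = 1) := by norm_num
      simp only [hne, if_false, mem_Icc]
      constructor <;> nlinarith
  · rw [lintegral_velocities hf hn hσ huu, ← ENNReal.ofReal_mul hlen, mul_comm]

/-- The condition `hp` ensures that all atoms beyond `p + h` at time `t₀` with speed at least `u`
started on the side `σ` of the origin, so that no part of the interval of initial positions is lost.
-/
theorem le_gasIntensity_crossing {vmin vmax : ℝ} (hfL : Measurable fL) (hfR : Measurable fR)
    {f : ℝ → ℝ} (hf : IsCutoffDensity vmin vmax f) {n σ : ℝ} (hn : 0 ≤ n)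
    (hσ : σ = 1 ∨ σ = -1) (hdens : ∀ z : ℝ × ℝ, 0 < σ * z.1 → gasDensity nL nR fL fR z = n * f z.2)
    {p h t₀ t₁ u u' : ℝ} (ht₀ : 0 ≤ t₀) (ht : t₀ ≤ t₁) (huu : u ≤ u')
    (hp : 0 < p + h + u * t₀) :
    ENNReal.ofReal (n * (∫ v in u..u', f v) * (u * (t₁ - t₀) - h))
      ≤ gasIntensity nL nR fL fR (crossing σ (p + h) p t₀ t₁ u u') := by
  have hm : 0 ≤ ∫ v in u..u', f v := intervalIntegral.integral_nonneg huu fun v _ => hf.nonneg v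
  have hV : MeasurableSet {v | u ≤ -(σ * v) ∧ -(σ * v) < u'} := by measurability
  refine le_of_eq_of_le ?_ (le_gasIntensity hfL hfR (measurableSet_crossing _ _ _ _ _ _ _) hV
    (g := fun v => n * f v) (y := fun v => if σ = 1 then p + h - v * t₀ else
      -(p + h) - v * t₀ - (u * (t₁ - t₀) - h))
    (len := u * (t₁ - t₀) - h) ?_)
  · rw [lintegral_velocities hf hn hσ huu, mul_comm,
      ENNReal.ofReal_mul' (mul_nonneg hn hm)]
  · rintro v ⟨h2, h3⟩ x hx
    have h6 : u * (t₁ - t₀) ≤ -(σ * v) * (t₁ - t₀) :=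
      mul_le_mul_of_nonneg_right h2 (by linarith)
    have h7 : u * t₀ ≤ -(σ * v) * t₀ := mul_le_mul_of_nonneg_right h2 ht₀
    have h8 : 0 < σ * x := by
      rcases hσ with rfl | rfl
      · simp only [if_true, mem_Icc] at hx
        nlinarith [hx.1]
      · have hne : ¬ ((-1 : ℝ) = 1) := by norm_num
        simp only [hne, if_false, mem_Icc] at hx
        nlinarith [hx.2]
    refine ⟨⟨h8, h2, h3, ?_, ?_⟩, (hdens (x, v) h8).ge⟩
    · rcases hσ with rfl | rfl
      · simp only [if_true, mem_Icc] at hx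
        simp only; linarith [hx.1]
      · have hne : ¬ ((-1 : ℝ) = 1) := by norm_num
        simp only [hne, if_false, mem_Icc] at hx
        simp only; linarith [hx.2]
    · rcases hσ with rfl | rfl
      · simp only [if_true, mem_Icc] at hx
        simp only; linarith [hx.2]
      · have hne : ¬ ((-1 : ℝ) = 1) := by norm_num
        simp only [hne, if_false, mem_Icc] at hx
        simp only; linarith [hx.1]

theorem gasIntensity_nearby_le {vmin vmax : ℝ} (hfL : IsCutoffDensity vmin vmax fL)
    (hfR : IsCutoffDensity vmin vmax fR) (hnL : 0 < nL) (hnR : 0 < nR) (p t : ℝ) {r : ℝ} (hr : 0 ≤ r) :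
    gasIntensity nL nR fL fR (nearby p r t) ≤ ENNReal.ofReal ((nL + nR) * (2 * r)) := by
  have hint : Integrable (fun v => nL * fL v + nR * fR v) :=
    (hfL.integrable.const_mul nL).add (hfR.integrable.const_mul nR)
  have hpos : ∀ v, 0 ≤ nL * fL v + nR * fR v := fun v =>
    add_nonneg (mul_nonneg hnL.le (hfL.nonneg v)) (mul_nonneg hnR.le (hfR.nonneg v))
  refine (gasIntensity_le hfL.measurable hfR.measurable (measurableSet_nearby p r t)
    MeasurableSet.univ (g := fun v => nL * fL v + nR * fR v) (y := fun v => p - r - v * t)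
    (len := 2 * r) ?_).trans_eq ?_
  · rintro ⟨x, v⟩ hz
    obtain ⟨h1, h2⟩ := abs_le.mp (show |x + v * t - p| ≤ r from hz)
    refine ⟨mem_univ _, ⟨by simp only; linarith, by simp only; linarith⟩, ?_⟩
    have h3 := mul_nonneg hnL.le (hfL.nonneg v)
    have h4 := mul_nonneg hnR.le (hfR.nonneg v)
    unfold gasDensity
    split_ifs <;> simp only <;> linarith
  · rw [setLIntegral_univ, ← ofReal_integral_eq_lintegral_ofReal hint
      (Filter.Eventually.of_forall hpos), integral_add (hfL.integrable.const_mul nL)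
      (hfR.integrable.const_mul nR), integral_const_mul, integral_const_mul, hfL.integral_eq_one,
      hfR.integral_eq_one, ← ENNReal.ofReal_mul (by linarith)]
    congr 1; ring

theorem gasIntensity_irregular {vmin vmax : ℝ} (hfL : IsCutoffDensity vmin vmax fL)
    (hfR : IsCutoffDensity vmin vmax fR) :
    gasIntensity nL nR fL fR {a | a.1 = 0 ∨ |a.2| ≤ vmin ∨ vmax ≤ |a.2|} = 0 := by
  unfold gasIntensity
  rw [withDensity_apply_eq_zero (measurable_gasDensity hfL.measurable hfR.measurable).ennreal_ofReal]
  convert measure_empty (μ := (volume : Measure (ℝ × ℝ)))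
  rw [eq_empty_iff_forall_notMem]
  rintro ⟨x, v⟩ ⟨h1, h2⟩
  apply h1
  rw [ENNReal.ofReal_eq_zero]
  unfold gasDensity
  rcases h2 with h2 | h2
  · simp only at h2
    simp [h2]
  · simp [hfL.cutoff v h2, hfR.cutoff v h2]

/-- Almost every configuration of the gas is regular. -/
theorem IsPoissonProcess.ae_regularGas {vmin vmax : ℝ} (hfL : IsCutoffDensity vmin vmax fL)
    (hfR : IsCutoffDensity vmin vmax fR) (hnL : 0 < nL) (hnR : 0 < nR) {Ω : Type*}
    [MeasurableSpace Ω] {μ : Measure Ω} {S : Ω → Set (ℝ × ℝ)}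
    (h : IsPoissonProcess μ (gasIntensity nL nR fL fR) S) (m M V₀ : ℝ) :
    ∀ᵐ ω ∂μ, RegularGas m M V₀ vmin vmax (S ω) := by
  have h1 : ∀ᵐ ω ∂μ, ∀ n : ℕ, (S ω ∩ nearby 0 n 0).Finite := by
    rw [ae_all_iff]
    intro n
    exact h.ae_finite (measurableSet_nearby _ _ _) (ne_top_of_le_ne_top ENNReal.ofReal_ne_top
      (gasIntensity_nearby_le hfL hfR hnL hnR 0 0 n.cast_nonneg))
  have hmeas : MeasurableSet {a : ℝ × ℝ | a.1 = 0 ∨ |a.2| ≤ vmin ∨ vmax ≤ |a.2|} :=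
    (measurableSet_eq_fun measurable_fst measurable_const).union
      ((measurableSet_le measurable_snd.abs measurable_const).union
        (measurableSet_le measurable_const measurable_snd.abs))
  filter_upwards [h1, h.ae_inter_eq_empty hmeas (gasIntensity_irregular hfL hfR),
    h.ae_generic gasIntensity_absolutelyContinuous m M V₀] with ω hfin hirr hgen
  have hreg : ∀ a ∈ S ω, ¬ (a.1 = 0 ∨ |a.2| ≤ vmin ∨ vmax ≤ |a.2|) := fun a ha h' =>
    (eq_empty_iff_forall_notMem.mp hirr) a ⟨ha, h'⟩
  refine ⟨fun a ha h0 => hreg a ha (Or.inl h0), fun a ha => ?_, fun a ha => ?_, fun r => ?_, hgen⟩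
  · exact not_le.mp fun h' => hreg a ha (Or.inr (Or.inl h'))
  · exact not_le.mp fun h' => hreg a ha (Or.inr (Or.inr h'))
  · obtain ⟨n, hn⟩ := exists_nat_ge r
    refine (hfin n).subset (inter_subset_inter_right _ fun a ha => ?_)
    simp only [nearby, mem_ofPred_eq, mul_zero, add_zero, sub_zero]
    exact le_trans ha hn

end

/-! ### Bins of speeds -/

/-- The mass that the density `f` gives to a bin of speeds. -/
noncomputable def binMass (f : ℝ → ℝ) (vmin δ : ℝ) (i : ℕ) : ℝ :=
  ∫ v in (vmin + i * δ)..(vmin + (i + 1 : ℕ) * δ), f v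

section

variable {vmin vmax δ : ℝ} {f : ℝ → ℝ} {K : ℕ}

theorem binMass_nonneg (hf : IsCutoffDensity vmin vmax f) (hδ : 0 < δ) (i : ℕ) :
    0 ≤ binMass f vmin δ i :=
  intervalIntegral.integral_nonneg (by push_cast; linarith) fun v _ => hf.nonneg v

/-- The cutoff confines the positive velocities to `(vmin, vmax)`, which the `K` bins exhaust. -/
theorem integral_Ioi_eq_sum_bins (hf : IsCutoffDensity vmin vmax f) (hvmin : 0 < vmin)
    (hδ : 0 < δ) (hK : vmin + K * δ = vmax) {w : ℝ → ℝ} (hw : Continuous w) :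
    ∫ v in Ioi 0, w v * f v = ∑ i ∈ Finset.range K,
      ∫ v in (vmin + i * δ)..(vmin + (i + 1 : ℕ) * δ), w v * f v := by
  have hint : ∀ a b : ℝ, IntervalIntegrable (fun v => w v * f v) volume a b := fun a b =>
    hf.integrable.intervalIntegrable.continuousOn_mul hw.continuousOn
  rw [intervalIntegral.sum_integral_adjacent_intervals (a := fun i : ℕ => vmin + i * δ)
    (fun k _ => hint _ _)]
  have hle : vmin ≤ vmin + K * δ := by
    have : 0 ≤ (K : ℝ) * δ := by positivity
    linarith
  simp only [CharP.cast_eq_zero, zero_mul, add_zero]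
  rw [intervalIntegral.integral_of_le hle, hK]
  refine (setIntegral_eq_of_subset_of_forall_sdiff_eq_zero measurableSet_Ioi
    (fun v hv => hvmin.trans hv.1) fun v hv => ?_)
  have h0 : (0 : ℝ) < v := hv.1
  have : |v| ≤ vmin ∨ vmax ≤ |v| := by
    rw [abs_of_pos h0]
    by_contra h
    push Not at h
    exact hv.2 ⟨h.1, h.2.le⟩
  rw [hf.cutoff v this, mul_zero]

theorem sum_binMass (hf : IsCutoffDensity vmin vmax f) (hvmin : 0 < vmin)
    (hδ : 0 < δ) (hK : vmin + K * δ = vmax) :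
    ∑ i ∈ Finset.range K, binMass f vmin δ i = 1 / 2 := by
  have h1 := integral_Ioi_eq_sum_bins hf hvmin hδ hK (w := fun _ => 1) continuous_const
  simp only [one_mul] at h1
  unfold binMass
  rw [← h1]
  have h2 := integral_comp_abs (f := f)
  have h3 : ∀ x, f |x| = f x := fun x => by
    rcases abs_choice x with h | h <;> rw [h]
    exact hf.symm x
  simp only [h3, hf.integral_eq_one] at h2
  linarith

theorem binMass_le_half (hf : IsCutoffDensity vmin vmax f) (hvmin : 0 < vmin)
    (hδ : 0 < δ) (hK : vmin + K * δ = vmax) {i : ℕ} (hi : i < K) : binMass f vmin δ i ≤ 1 / 2 := by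
  rw [← sum_binMass hf hvmin hδ hK]
  exact Finset.single_le_sum (fun i _ => binMass_nonneg hf hδ i) (Finset.mem_range.mpr hi)

theorem sum_binMass_mul_sq_le (hf : IsCutoffDensity vmin vmax f) (hvmin : 0 < vmin)
    (hδ : 0 < δ) (hK : vmin + K * δ = vmax) :
    ∑ i ∈ Finset.range K, binMass f vmin δ i * (vmin + i * δ) ^ 2
      ≤ ∫ v in Ioi 0, v ^ 2 * f v := by
  rw [integral_Ioi_eq_sum_bins hf hvmin hδ hK (continuous_pow 2)]
  refine Finset.sum_le_sum fun i _ => ?_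
  have h0 : 0 ≤ (i : ℝ) * δ := by positivity
  rw [mul_comm, binMass, ← intervalIntegral.integral_const_mul]
  refine intervalIntegral.integral_mono_on (by push_cast; linarith)
    (hf.integrable.intervalIntegrable.const_mul _)
    (hf.integrable.intervalIntegrable.continuousOn_mul (continuous_pow 2).continuousOn)
    fun v hv => ?_
  have := hf.nonneg v
  have := hv.1
  gcongr

theorem le_sum_binMass_mul_sq (hf : IsCutoffDensity vmin vmax f) (hvmin : 0 < vmin)
    (hδ : 0 < δ) (hK : vmin + K * δ = vmax) :
    ∫ v in Ioi 0, v ^ 2 * f v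
      ≤ ∑ i ∈ Finset.range K, binMass f vmin δ i * (vmin + (i + 1 : ℕ) * δ) ^ 2 := by
  rw [integral_Ioi_eq_sum_bins hf hvmin hδ hK (continuous_pow 2)]
  refine Finset.sum_le_sum fun i _ => ?_
  have h0 : 0 ≤ (i : ℝ) * δ := by positivity
  rw [mul_comm (binMass _ _ _ _), binMass, ← intervalIntegral.integral_const_mul]
  refine intervalIntegral.integral_mono_on (by push_cast; linarith)
    (hf.integrable.intervalIntegrable.continuousOn_mul (continuous_pow 2).continuousOn)
    (hf.integrable.intervalIntegrable.const_mul _) fun v hv => ?_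
  have := hf.nonneg v
  have := hv.2
  have := hv.1
  gcongr
  linarith

end

/-- The upper bound for the number of atoms in a bin that hit the piston in a window. -/
noncomputable def upperCount (n : ℝ) (f : ℝ → ℝ) (vmin δ η τ : ℝ) (i : ℕ) : ℝ :=
  τ * (n * binMass f vmin δ i * (vmin + (i + 1 : ℕ) * δ + η) + η)

/-- The lower bound for the number of atoms in a bin that hit the piston in a window. -/
noncomputable def lowerCount (n : ℝ) (f : ℝ → ℝ) (vmin δ η τ : ℝ) (i : ℕ) : ℝ :=
  τ * (n * binMass f vmin δ i * (vmin + i * δ - η) - η)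

/-- Pressure balance enters here. The constant `12` is twice that of `bin_balance`, because by
evenness the bins carry only half of the mass of `f`. -/
theorem sum_upperCount_le {vmin vmax c δ η τ n n' : ℝ} {f f' : ℝ → ℝ} {K : ℕ}
    (hf : IsCutoffDensity vmin vmax f) (hf' : IsCutoffDensity vmin vmax f')
    (hvmin : 0 < vmin) (hc : 0 < c) (hcv : c ≤ vmin) (hδ : 0 < δ) (hη : 0 < η) (hτ : 0 < τ)
    (hK : vmin + K * δ = vmax) (hn : 0 < n) (hn' : 0 < n')
    (hbal : n * ∫ v in Ioi (0 : ℝ), v ^ 2 * f v = n' * ∫ v in Ioi (0 : ℝ), v ^ 2 * f' v)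
    (h1 : 4 * vmax * (δ + η) ≤ c * vmin) (h2 : 12 * vmax * K * η ≤ n * (c * vmin)) :
    ∑ i ∈ Finset.range K, (vmin + (i + 1 : ℕ) * δ - c) * upperCount n f vmin δ η τ i
      ≤ ∑ i ∈ Finset.range K, (vmin + i * δ + c) * lowerCount n' f' vmin δ η τ i := by
  have hPQ : ∑ i ∈ Finset.range K, n * binMass f vmin δ i * (vmin + i * δ) ^ 2
      ≤ ∑ i ∈ Finset.range K, n' * binMass f' vmin δ i * (vmin + (i + 1 : ℕ) * δ) ^ 2 := by
    simp only [mul_assoc, ← Finset.mul_sum]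
    have e1 := mul_le_mul_of_nonneg_left (sum_binMass_mul_sq_le hf hvmin hδ hK) hn.le
    have e2 := mul_le_mul_of_nonneg_left (le_sum_binMass_mul_sq hf' hvmin hδ hK) hn'.le
    linarith
  have key := bin_balance (g := n / 2) hvmin hc hcv hδ hη hK
    (fun i => mul_nonneg hn.le (binMass_nonneg hf hδ i))
    (fun i => mul_nonneg hn'.le (binMass_nonneg hf' hδ i)) hPQ
    (by rw [← Finset.mul_sum, sum_binMass hf hvmin hδ hK]; linarith) h1 (by linarith)
  have := mul_le_mul_of_nonneg_left key hτ.le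
  rw [Finset.mul_sum, Finset.mul_sum] at this
  unfold upperCount lowerCount
  calc _ = _ := Finset.sum_congr rfl fun i _ => by ring
    _ ≤ _ := this
    _ = _ := Finset.sum_congr rfl fun i _ => by ring

/-! ### Atypical numbers of atoms are improbable -/

section

variable {vmin vmax nL nR : ℝ} {fL fR : ℝ → ℝ} {Ω : Type*} [MeasurableSpace Ω] {μ : Measure Ω}
  {S : Ω → Set (ℝ × ℝ)}

/-- Chernoff's bound for two counts in each of `K` bins. Means are of order `τ` and the allowed
deviation is `η * τ`, so the bound is exponentially small in `τ`. -/
theorem measure_not_countsBetween_le (hS : IsPoissonProcess μ (gasIntensity nL nR fL fR) S)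
    (hfL : Measurable fL) (hfR : Measurable fR) {f : ℝ → ℝ} (hf : IsCutoffDensity vmin vmax f)
    {n σ : ℝ} (hn : 0 ≤ n) (hσ : σ = 1 ∨ σ = -1)
    (hdens : ∀ z : ℝ × ℝ, 0 < σ * z.1 → gasDensity nL nR fL fR z = n * f z.2)
    (hvmin : 0 < vmin) {δ η τ r p t : ℝ} {K : ℕ} (hδ : 0 < δ)
    (hK : vmin + K * δ = vmax) (hη : 0 < η) (hτ : 0 < τ) (ht : 0 ≤ t)
    (hr : 0 ≤ r) (hr1 : r ≤ 1) (hrη : n * (vmax + η) * r ≤ η)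
    (hp : 0 < p + η * τ + vmin * t) :
    μ {ω | ¬ CountsBetween (S ω) vmin δ (η * τ) t (t + τ) K (upperCount n f vmin δ η τ)
      (lowerCount n f vmin δ η τ) σ p}
      ≤ K * (2 * ENNReal.ofReal (Real.exp (-(r * (η * τ) / 2)))) := by
  have hvmax : 0 < vmax + η := by
    have : 0 ≤ (K : ℝ) * δ := by positivity
    linarith
  have hitem : ∀ i ∈ Finset.range K,
      μ {ω | ¬ (CountLE (S ω) (crossing σ p (p + η * τ) t (t + τ) (vmin + i * δ)
          (vmin + (i + 1 : ℕ) * δ)) (upperCount n f vmin δ η τ i) ∧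
        CountGE (S ω) (crossing σ (p + η * τ) p t (t + τ) (vmin + i * δ)
          (vmin + (i + 1 : ℕ) * δ)) (lowerCount n f vmin δ η τ i))}
      ≤ 2 * ENNReal.ofReal (Real.exp (-(r * (η * τ) / 2))) := by
    intro i hi
    have hi' := Finset.mem_range.mp hi
    have h0 : 0 ≤ (i : ℝ) * δ := by positivity
    have hmass := binMass_nonneg hf hδ i
    have hhalf := binMass_le_half hf hvmin hδ hK hi'
    have huu : vmin + i * δ ≤ vmin + (i + 1 : ℕ) * δ := by push_cast; linarith
    have huv : vmin + (i + 1 : ℕ) * δ ≤ vmax := by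
      rw [← hK]
      have : ((i + 1 : ℕ) : ℝ) ≤ K := by exact_mod_cast hi'
      gcongr
    have hup := gasIntensity_crossing_le hfL hfR hf hn hσ hdens (p := p) (h := η * τ)
      (t₀ := t) (t₁ := t + τ) (u := vmin + i * δ) (u' := vmin + (i + 1 : ℕ) * δ) (by linarith)
      (by positivity) (by linarith) huu
    have hlo := le_gasIntensity_crossing hfL hfR hf hn hσ hdens (p := p) (h := η * τ)
      (t₀ := t) (t₁ := t + τ) (u := vmin + i * δ) (u' := vmin + (i + 1 : ℕ) * δ) ht (by linarith)
      huu (by nlinarith)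
    rw [add_sub_cancel_left] at hup hlo
    -- The lower tail also needs an upper bound for the mean; the smaller crossing set inherits that
    -- of the larger one.
    have hsub : gasIntensity nL nR fL fR (crossing σ (p + η * τ) p t (t + τ) (vmin + i * δ)
        (vmin + (i + 1 : ℕ) * δ)) ≤ gasIntensity nL nR fL fR (crossing σ p (p + η * τ) t (t + τ)
        (vmin + i * δ) (vmin + (i + 1 : ℕ) * δ)) := by
      refine measure_mono fun a ha => ?_
      obtain ⟨h1, h2, h3, h4, h5⟩ := ha
      have : 0 < η * τ := by positivity
      exact ⟨h1, h2, h3, by linarith, by linarith⟩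
    set L := n * binMass f vmin δ i * ((vmin + (i + 1 : ℕ) * δ) * τ + η * τ) with hL
    have hu0 : 0 ≤ vmin + (i + 1 : ℕ) * δ := by linarith
    have hL0 : 0 ≤ L := by positivity
    have hLr : 2 * (L * r) ≤ η * τ := by
      -- The factor `1 / 2` from the mass of a bin cancels the `2` in the condition of the Chernoff
      -- bound.
      have h1 : L ≤ n * (1 / 2) * ((vmax + η) * τ) := by
        rw [hL, ← add_mul]
        gcongr
      have h2 := mul_le_mul_of_nonneg_right h1 hr
      have h3 := mul_le_mul_of_nonneg_right hrη hτ.le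
      nlinarith
    have b1 := measure_not_countLE_add_le hS (measurableSet_crossing _ _ _ _ _ _ _) hL0 hup hr hr1
      hLr
    have b2 := measure_not_countGE_sub_le hS (measurableSet_crossing _ _ _ _ _ _ _)
      (ne_top_of_le_ne_top ENNReal.ofReal_ne_top (hsub.trans hup)) hL0 hlo (hsub.trans hup) hr hr1
      hLr
    have e1 : upperCount n f vmin δ η τ i = L + η * τ := by
      rw [hL]; unfold upperCount; ring
    have e2 : lowerCount n f vmin δ η τ i
        = n * binMass f vmin δ i * ((vmin + i * δ) * τ - η * τ) - η * τ := by
      unfold lowerCount; ring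
    rw [e1, e2, two_mul]
    refine le_trans (measure_mono fun ω hω => ?_) ((measure_union_le _ _).trans (add_le_add b1 b2))
    exact not_and_or.mp hω
  calc _ ≤ μ (⋃ i ∈ Finset.range K,
          {ω | ¬ (CountLE (S ω) (crossing σ p (p + η * τ) t (t + τ) (vmin + i * δ)
            (vmin + (i + 1 : ℕ) * δ)) (upperCount n f vmin δ η τ i) ∧
          CountGE (S ω) (crossing σ (p + η * τ) p t (t + τ) (vmin + i * δ)
            (vmin + (i + 1 : ℕ) * δ)) (lowerCount n f vmin δ η τ i))}) := by
        refine measure_mono fun ω hω => ?_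
        have hω' : ¬ CountsBetween (S ω) vmin δ (η * τ) t (t + τ) K (upperCount n f vmin δ η τ)
          (lowerCount n f vmin δ η τ) σ p := hω
        unfold CountsBetween at hω'
        push Not at hω'
        obtain ⟨i, hi, h⟩ := hω'
        exact mem_biUnion (Finset.mem_range.mpr hi) fun h' => absurd h'.2 (h h'.1)
    _ ≤ ∑ i ∈ Finset.range K, 2 * ENNReal.ofReal (Real.exp (-(r * (η * τ) / 2))) :=
        (measure_biUnion_finset_le _ _).trans (Finset.sum_le_sum hitem)
    _ = _ := by rw [Finset.sum_const, Finset.card_range, nsmul_eq_mul]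

/-- The numbers of atoms that can reach or cross the interval `[p, p + η τ]` in the window
`[t, t + τ]` are typical. -/
def TypicalCell (nL nR : ℝ) (fL fR : ℝ → ℝ) (vmin vmax δ η τ rate t : ℝ) (K : ℕ)
    (A : Set (ℝ × ℝ)) (p : ℝ) : Prop :=
  CountLE A (nearby p (2 * vmax * τ + η * τ) t) (rate * τ + η * τ) ∧
  CountsBetween A vmin δ (η * τ) t (t + τ) K (upperCount nR fR vmin δ η τ)
    (lowerCount nR fR vmin δ η τ) 1 p ∧
  CountsBetween A vmin δ (η * τ) t (t + τ) K (upperCount nL fL vmin δ η τ)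
    (lowerCount nL fL vmin δ η τ) (-1) p

/-- `rate * τ` bounds the mean number of atoms within reach, and `1 + 4 * K` is the number of tail
events: one for the nearby atoms, two for each bin on each side. -/
theorem measure_not_typicalCell_le (hS : IsPoissonProcess μ (gasIntensity nL nR fL fR) S)
    (hfL : IsCutoffDensity vmin vmax fL) (hfR : IsCutoffDensity vmin vmax fR)
    (hnL : 0 < nL) (hnR : 0 < nR) (hvmin : 0 < vmin) {δ η τ r p t rate : ℝ} {K : ℕ} (hδ : 0 < δ)
    (hK : vmin + K * δ = vmax) (hη : 0 < η) (hτ : 0 < τ) (ht : 0 ≤ t)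
    (hr : 0 ≤ r) (hr1 : r ≤ 1) (hrate : rate = (nL + nR) * (4 * vmax + 2 * η))
    (hrη : 2 * (rate * r) ≤ η) (hp : 0 < p + η * τ + vmin * t) :
    μ {ω | ¬ TypicalCell nL nR fL fR vmin vmax δ η τ rate t K (S ω) p}
      ≤ ENNReal.ofReal ((1 + 4 * K) * Real.exp (-(r * (η * τ) / 2))) := by
  have hvmax : 0 < vmax := by
    have : 0 ≤ (K : ℝ) * δ := by positivity
    linarith
  have hrate0 : 0 ≤ rate := by rw [hrate]; positivity
  have c1 := measure_not_countLE_add_le hS (measurableSet_nearby p (2 * vmax * τ + η * τ) t)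
    (L := rate * τ) (a := η * τ) (s := r) (by positivity)
    ((gasIntensity_nearby_le hfL hfR hnL hnR p t (by positivity)).trans_eq
      (by rw [hrate]; ring_nf)) hr hr1
    (by have := mul_le_mul_of_nonneg_right hrη hτ.le; nlinarith)
  have hside : ∀ n : ℝ, 0 < n → n ≤ nL + nR → n * (vmax + η) * r ≤ η := by
    intro n hn hle
    refine le_trans ?_ hrη
    rw [hrate]
    have : n * (vmax + η) ≤ 2 * ((nL + nR) * (4 * vmax + 2 * η)) := by
      have := mul_le_mul hle (by linarith : vmax + η ≤ 4 * vmax + 2 * η) (by positivity)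
        (by positivity)
      have h4 : 0 ≤ (nL + nR) * (4 * vmax + 2 * η) := by positivity
      linarith
    have := mul_le_mul_of_nonneg_right this hr
    linarith
  have c2 := measure_not_countsBetween_le hS hfL.measurable hfR.measurable hfR hnR.le
    (Or.inl rfl) (fun z hz => by unfold gasDensity; rw [if_pos (by linarith)]) hvmin hδ hK hη hτ
    ht hr hr1 (hside nR hnR (by linarith)) hp
  have c3 := measure_not_countsBetween_le hS hfL.measurable hfR.measurable hfL hnL.le
    (Or.inr rfl) (fun z hz => by
      unfold gasDensity; rw [if_neg (by linarith), if_pos (by linarith)]) hvmin hδ hK hη hτ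
    ht hr hr1 (hside nL hnL (by linarith)) hp
  refine le_trans (measure_mono (t := _ ∪ (_ ∪ _)) fun ω hω => ?_)
    ((measure_union_le _ _).trans (add_le_add c1
      ((measure_union_le _ _).trans (add_le_add c2 c3)))) |>.trans_eq ?_
  · rcases not_and_or.mp hω with h | h
    · exact Or.inl h
    · exact Or.inr (not_and_or.mp h)
  · rw [ENNReal.ofReal_mul (by positivity), ENNReal.ofReal_add (by norm_num) (by positivity),
      ENNReal.ofReal_mul (by norm_num), ENNReal.ofReal_natCast, ENNReal.ofReal_one,
      ENNReal.ofReal_ofNat]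
    ring

end

/-! ### The velocities coincide with high probability -/

theorem CountLE.floor {A D : Set (ℝ × ℝ)} {r : ℝ} (h : CountLE A D r) :
    CountLE A D (⌊r⌋₊ : ℕ) := by
  obtain ⟨n, hn, hr⟩ := h
  exact ⟨n, hn, by exact_mod_cast Nat.le_floor hr⟩

/-- The event need not be measurable; the complement of a measurable hull of its complement serves
as a subset. -/
theorem exists_measurableSet_of_measure_not_le {Ω : Type*} [MeasurableSpace Ω] {μ : Measure Ω}
    [IsProbabilityMeasure μ] {P : Ω → Prop} {x : ℝ} (hx : 0 ≤ x)
    (h : μ {ω | ¬ P ω} ≤ ENNReal.ofReal x) :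
    ∃ G : Set Ω, MeasurableSet G ∧ (∀ ω ∈ G, P ω) ∧ 1 - x ≤ μ.real G := by
  have hm := measurableSet_toMeasurable μ {ω | ¬ P ω}
  refine ⟨(toMeasurable μ {ω | ¬ P ω})ᶜ, hm.compl, fun ω hω => ?_, ?_⟩
  · by_contra hP
    exact hω (subset_toMeasurable _ _ hP)
  · rw [probReal_compl_eq_one_sub hm]
    have : μ.real (toMeasurable μ {ω | ¬ P ω}) ≤ x := by
      rw [measureReal_def, measure_toMeasurable]
      exact ENNReal.toReal_le_of_le_ofReal hx h
    linarith

section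

variable {vmin vmax nL nR : ℝ} {fL fR : ℝ → ℝ} {Ω : Type*} [MeasurableSpace Ω] {μ : Measure Ω}
  {S : Ω → Set (ℝ × ℝ)}

theorem measure_not_coincide_le_sq (hS : IsPoissonProcess μ (gasIntensity nL nR fL fR) S)
    (hfL : IsCutoffDensity vmin vmax fL) (hfR : IsCutoffDensity vmin vmax fR)
    (hnL : 0 < nL) (hnR : 0 < nR) (hvm : vmin < vmax) {m M b V₀ T : ℝ} {N : ℕ}
    (hR : SlowRegime m M b vmin) (hV : |V₀| ≤ b / 2) (hT : 0 < T) (hT1 : T ≤ 1)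
    (hN : kick m M * (2 * vmax) * N ≤ b / 2) (hN2 : 2 ≤ N) :
    μ {ω | ¬ VelocitiesCoincide m M b V₀ (S ω) T} ≤ ENNReal.ofReal
      (T ^ 2 * Real.exp ((nL + nR) * (4 * vmax) * Real.exp 1 - N)) := by
  have hvmax : 0 < vmax := hR.vmin_pos.trans hvm
  have hreg := hS.ae_regularGas hfL hfR hnL hnR m M V₀
  rw [ae_iff] at hreg
  have hcount := measure_not_countLE_le_sq hS (measurableSet_nearby 0 (2 * vmax * T) 0)
    (C := (nL + nR) * (4 * vmax)) (by positivity) hT hT1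
    ((gasIntensity_nearby_le hfL hfR hnL hnR 0 0 (by positivity)).trans_eq (by ring_nf)) hN2
  calc _ ≤ μ ({ω | ¬ RegularGas m M V₀ vmin vmax (S ω)} ∪
          {ω | ¬ CountLE (S ω) (nearby 0 (2 * vmax * T) 0) N}) := by
        refine measure_mono fun ω hω => ?_
        by_contra h
        rw [mem_union, not_or] at h
        exact hω (coincide_of_few hR (not_not.mp h.1) hvm hV hN (not_not.mp h.2))
    _ ≤ 0 + _ := (measure_union_le _ _).trans (add_le_add hreg.le hcount)
    _ = _ := zero_add _

/-- A union bound over `n` windows and `2 * J + 1` cells; since the speed is at most `b`, these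
cells contain all positions the piston can have. -/
theorem measure_not_coincide_le (hS : IsPoissonProcess μ (gasIntensity nL nR fL fR) S)
    (hfL : IsCutoffDensity vmin vmax fL) (hfR : IsCutoffDensity vmin vmax fR)
    (hnL : 0 < nL) (hnR : 0 < nR) (hvm : vmin < vmax) (hbal : PressureBalance nL nR fL fR)
    {m M b V₀ T : ℝ} (hR : SlowRegime m M b vmin) (hV : |V₀| ≤ b / 2) {δ η τ r rate : ℝ}
    {K n J : ℕ} (hδ : 0 < δ) (hK : vmin + K * δ = vmax) (hη : 0 < η) (hτ : 0 < τ)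
    (h1 : 4 * vmax * (δ + η) ≤ b / 8 * vmin) (h2L : 12 * vmax * K * η ≤ nL * (b / 8 * vmin))
    (h2R : 12 * vmax * K * η ≤ nR * (b / 8 * vmin))
    (hr : 0 ≤ r) (hr1 : r ≤ 1) (hrate : rate = (nL + nR) * (4 * vmax + 2 * η))
    (hrη : 2 * (rate * r) ≤ η) (hN : kick m M * (2 * vmax) * ((rate + η) * τ) ≤ b / 8)
    (hT : T ≤ n * τ) (hJ : b * n / η + 1 ≤ J) :
    μ {ω | ¬ VelocitiesCoincide m M b V₀ (S ω) T} ≤ ENNReal.ofReal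
      (n * ((2 * J + 1) * ((1 + 4 * K) * Real.exp (-(r * (η * τ) / 2))))) := by
  have hvmin := hR.vmin_pos
  have hvmax : 0 < vmax := hvmin.trans hvm
  have hb := hR.b_pos
  have hbv := hR.b_lt_vmin
  have hrate0 : 0 ≤ rate := by rw [hrate]; positivity
  have hητ : 0 < η * τ := by positivity
  have hreg := hS.ae_regularGas hfL hfR hnL hnR m M V₀
  rw [ae_iff] at hreg
  -- The inequality discards cells out of reach by the time `k * τ`. For the remaining ones `b <
  -- vmin` gives the positivity on which the lower bound for the intensity rests. Left atoms are
  -- counted in reflected coordinates, so one grid serves `x` and `-x`.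
  let Bad : ℕ → ℤ → Set Ω := fun k j => {ω | -(b * (k * τ)) < j * (η * τ) + η * τ ∧
    ¬ TypicalCell nL nR fL fR vmin vmax δ η τ rate (k * τ) K (S ω) (j * (η * τ))}
  have hBad : ∀ k j, μ (Bad k j)
      ≤ ENNReal.ofReal ((1 + 4 * K) * Real.exp (-(r * (η * τ) / 2))) := by
    intro k j
    by_cases hrel : -(b * (k * τ)) < j * (η * τ) + η * τ
    · have hkτ : 0 ≤ (k : ℝ) * τ := by positivity
      refine le_trans (measure_mono fun ω hω => hω.2) (measure_not_typicalCell_le hS hfL hfR hnL hnR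
        hvmin hδ hK hη hτ hkτ hr hr1 hrate hrη ?_)
      nlinarith
    · have : Bad k j = ∅ := eq_empty_of_forall_notMem fun ω hω => hrel hω.1
      rw [this, measure_empty]; exact zero_le
  have hincl : {ω | ¬ VelocitiesCoincide m M b V₀ (S ω) T} ⊆
      {ω | ¬ RegularGas m M V₀ vmin vmax (S ω)} ∪
        ⋃ k ∈ Finset.range n, ⋃ j ∈ Finset.Icc (-(J : ℤ)) J, Bad k j := by
    intro ω hω
    by_contra hgood
    rw [mem_union, not_or] at hgood
    obtain ⟨hA, hcells⟩ := hgood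
    have hA := not_not.mp hA
    have hcell : ∀ k < n, ∀ x : ℝ, |x| ≤ b * (k * τ) → ∃ p ≤ x, x < p + η * τ ∧
        TypicalCell nL nR fL fR vmin vmax δ η τ rate (k * τ) K (S ω) p := by
      intro k hk x hx
      have hfl := Int.floor_le (x / (η * τ))
      have hfl' := Int.lt_floor_add_one (x / (η * τ))
      set j := ⌊x / (η * τ)⌋ with hj
      obtain ⟨hx1, hx2⟩ := abs_le.mp hx
      rw [le_div_iff₀ hητ] at hfl
      rw [div_lt_iff₀ hητ] at hfl'
      have hkn : b * (k * τ) ≤ (J - 1) * (η * τ) := by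
        have h3 : b * n / η ≤ J - 1 := by linarith
        rw [div_le_iff₀ hη] at h3
        have h4 : b * (k : ℝ) ≤ b * n := by
          have : (k : ℝ) ≤ n := by exact_mod_cast hk.le
          gcongr
        have h5 := mul_le_mul_of_nonneg_right (h4.trans h3) hτ.le
        linarith
      have hj1 : (j : ℝ) ≤ J := by
        by_contra hcon
        push Not at hcon
        nlinarith
      have hj2 : -(J : ℝ) ≤ j := by
        by_contra hcon
        push Not at hcon
        nlinarith
      refine ⟨j * (η * τ), hfl, by linarith, ?_⟩
      by_contra hbad
      refine hcells (mem_biUnion (Finset.mem_range.mpr hk) (mem_biUnion (x := j) ?_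
        ⟨by linarith, hbad⟩))
      rw [Finset.mem_coe, Finset.mem_Icc]
      exact ⟨by exact_mod_cast hj2, by exact_mod_cast hj1⟩
    have hnext : ∀ k : ℕ, (k : ℝ) * τ + τ = (k + 1 : ℕ) * τ := fun k => by push_cast; ring
    have hmain := exists_historyAt_of_counts hR hA hvm hV (h := η * τ)
      (N := ⌊rate * τ + η * τ⌋₊) (n := n) hτ hδ hK ?_ ?_
      (sum_upperCount_le hfL hfR hvmin (by linarith) (by linarith) hδ hη hτ hK hnL hnR hbal h1 h2L)
      (sum_upperCount_le hfR hfL hvmin (by linarith) (by linarith) hδ hη hτ hK hnR hnL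
        (Eq.symm hbal) h1 h2R)
    · refine hω fun t ht => ?_
      obtain ⟨s, l, h⟩ := (hmain n le_rfl).2 t ht.1.le (ht.2.le.trans hT)
      exact h.velocities
    · have hfloor := Nat.floor_le (by positivity : 0 ≤ rate * τ + η * τ)
      have := kick_pos hR.m_pos hR.M_pos
      refine le_trans ?_ hN
      rw [add_mul]
      gcongr
    · intro k hk x hx
      refine ⟨?_, ?_⟩
      · obtain ⟨p, hp, hp', hc1, hc2, -⟩ := hcell k hk x hx
        rw [hnext] at hc2
        exact ⟨p, hp, hp', hc1.floor, hc2⟩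
      · obtain ⟨p, hp, hp', -, -, hc3⟩ := hcell k hk (-x) (by rwa [abs_neg])
        rw [hnext] at hc3
        exact ⟨p, hp, hp', hc3⟩
  set q := (1 + 4 * (K : ℝ)) * Real.exp (-(r * (η * τ) / 2)) with hq
  have hq0 : 0 ≤ q := by positivity
  calc _ ≤ μ ({ω | ¬ RegularGas m M V₀ vmin vmax (S ω)} ∪
        ⋃ k ∈ Finset.range n, ⋃ j ∈ Finset.Icc (-(J : ℤ)) J, Bad k j) := measure_mono hincl
    _ ≤ 0 + ∑ k ∈ Finset.range n, ∑ j ∈ Finset.Icc (-(J : ℤ)) J, ENNReal.ofReal q := by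
        refine (measure_union_le _ _).trans (add_le_add hreg.le ?_)
        refine (measure_biUnion_finset_le _ _).trans (Finset.sum_le_sum fun k _ => ?_)
        exact (measure_biUnion_finset_le _ _).trans (Finset.sum_le_sum fun j _ => hBad k j)
    _ = _ := by
        have hcard : ((Finset.Icc (-(J : ℤ)) J).card : ℝ≥0∞) = ENNReal.ofReal (2 * J + 1) := by
          have : (Finset.Icc (-(J : ℤ)) J).card = 2 * J + 1 := by
            rw [Int.card_Icc]; omega
          rw [this, ← ENNReal.ofReal_natCast]
          push_cast
          rfl
        rw [zero_add, Finset.sum_const, Finset.sum_const, Finset.card_range, nsmul_eq_mul,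
          nsmul_eq_mul, hcard, ← ENNReal.ofReal_mul (by positivity), ← ENNReal.ofReal_natCast,
          ← ENNReal.ofReal_mul (by positivity)]

end

/-! ### Small mass ratios -/

/-- With `y = ε⁻¹` the right side is `exp (-(log y * log (log y)))`; here `log (log y) ≤ log y`, and
eventually both `log y ^ 2` and `C` are at most `c / 2 * y`. -/
theorem exists_exp_le_rpow_log_log (C : ℝ) {c : ℝ} (hc : 0 < c) :
    ∃ ε₀ : ℝ, 0 < ε₀ ∧ ∀ ε : ℝ, 0 < ε → ε < ε₀ →
      Real.exp (C - c / ε) ≤ ε ^ (1 * Real.log (Real.log ε⁻¹)) := by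
  have h1 := (Real.isLittleO_pow_log_id_atTop (n := 2)).bound (half_pos hc)
  have h2 := Filter.eventually_ge_atTop (2 * |C| / c)
  obtain ⟨y₀, hy₀⟩ := Filter.eventually_atTop.mp (h1.and (h2.and (Filter.eventually_gt_atTop 1)))
  refine ⟨(max y₀ 1)⁻¹, by positivity, fun ε hε hlt => ?_⟩
  have hy : max y₀ 1 ≤ ε⁻¹ := (le_inv_comm₀ (by positivity) hε).mpr hlt.le
  obtain ⟨g1, g2, g3⟩ := hy₀ ε⁻¹ ((le_max_left _ _).trans hy)
  set y := ε⁻¹ with hydef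
  have hL : 0 < Real.log y := Real.log_pos g3
  have g4 : Real.log y ^ 2 ≤ c / 2 * y := by
    have hy0 : 0 < y := by positivity
    simpa [abs_of_pos hy0] using g1
  have g5 : C ≤ c / 2 * y := by
    rw [div_le_iff₀ hc] at g2
    linarith [le_abs_self C]
  have g6 : Real.log (Real.log y) ≤ Real.log y := by
    linarith [Real.log_le_sub_one_of_pos hL]
  have e : Real.log ε = -Real.log y := by rw [hydef, Real.log_inv, neg_neg]
  rw [Real.rpow_def_of_pos hε, Real.exp_le_exp, e, one_mul, div_eq_mul_inv]
  nlinarith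

end Piston

/-! ### Choice of the constants -/

theorem mainTheorem5
    (vmin vmax : ℝ) (hvmin : 0 < vmin) (hvmax : vmin < vmax)
    (nL nR : ℝ) (hnL : 0 < nL) (hnR : 0 < nR)
    (fL fR : ℝ → ℝ)
    (hfL : Piston.IsCutoffDensity vmin vmax fL) (hfR : Piston.IsCutoffDensity vmin vmax fR)
    (hbal : Piston.PressureBalance nL nR fL fR) :
    ∃ d : ℝ, 0 < d ∧
      ∀ b : ℝ, 0 < b →
      ∃ ε₀ : ℝ, 0 < ε₀ ∧
        ∀ m M : ℝ, 0 < m → 0 < M → m / M < ε₀ → b < Piston.maxSpeed m M vmin →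
        ∀ V₀ : ℝ, |V₀| < Real.sqrt (m / M) →
        ∀ (Ω : Type*) [MeasurableSpace Ω] (μ : Measure Ω) [IsProbabilityMeasure μ]
          (S : Ω → Set (ℝ × ℝ)),
          Piston.IsPoissonProcess μ (Piston.gasIntensity nL nR fL fR) S →
        ∀ T : ℝ, 0 < T →
          ∃ G : Set Ω, MeasurableSet G ∧
            (∀ ω ∈ G, Piston.VelocitiesCoincide m M b V₀ (S ω) T) ∧
            1 - T ^ 2 * (m / M) ^ (d * Real.log (Real.log (m / M)⁻¹)) ≤ μ.real G := by
  refine ⟨1, one_pos, fun b hb => ?_⟩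
  have hvmax0 : 0 < vmax := hvmin.trans hvmax
  -- `D` is the common bound for `δ` and `η` that makes the errors of bins and cells smaller than
  -- the drag at speed `b / 8`.
  obtain ⟨D, hD⟩ : ∃ D, D = b / 8 * vmin / (8 * vmax) := ⟨_, rfl⟩
  have hD0 : 0 < D := by rw [hD]; positivity
  obtain ⟨K, hK⟩ := exists_nat_gt ((vmax - vmin) / D)
  have hK0 : (0 : ℝ) < K := lt_trans (div_pos (by linarith) hD0) hK
  obtain ⟨δ, hδ⟩ : ∃ δ, δ = (vmax - vmin) / K := ⟨_, rfl⟩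
  have hδ0 : 0 < δ := by rw [hδ]; exact div_pos (by linarith) hK0
  have hKδ : vmin + K * δ = vmax := by rw [hδ]; field_simp; ring
  have hδD : δ ≤ D := by
    rw [div_lt_iff₀ hD0] at hK
    rw [hδ, div_le_iff₀ hK0]
    linarith
  obtain ⟨η, hη⟩ : ∃ η, η = min D (min nL nR * (b / 8 * vmin) / (12 * vmax * K)) := ⟨_, rfl⟩
  have hmin : 0 < min nL nR := lt_min hnL hnR
  have hη0 : 0 < η := by rw [hη]; exact lt_min hD0 (by positivity)
  have hηD : η ≤ D := by rw [hη]; exact min_le_left _ _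
  have h1 : 4 * vmax * (δ + η) ≤ b / 8 * vmin := by
    have e : 4 * vmax * (D + D) = b / 8 * vmin := by rw [hD]; field_simp; ring
    rw [← e]
    gcongr
  have h2 : 12 * vmax * K * η ≤ min nL nR * (b / 8 * vmin) := by
    have : η ≤ min nL nR * (b / 8 * vmin) / (12 * vmax * K) := by rw [hη]; exact min_le_right _ _
    rw [le_div_iff₀ (by positivity)] at this
    linarith
  have hbv : 0 ≤ b / 8 * vmin := by positivity
  obtain ⟨rate, hrate⟩ : ∃ rate, rate = (nL + nR) * (4 * vmax + 2 * η) := ⟨_, rfl⟩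
  have hrate0 : 0 < rate := by rw [hrate]; positivity
  obtain ⟨r, hr⟩ : ∃ r, r = min 1 (η / (2 * rate)) := ⟨_, rfl⟩
  have hr0 : 0 < r := by rw [hr]; exact lt_min one_pos (by positivity)
  have hr1 : r ≤ 1 := by rw [hr]; exact min_le_left _ _
  have hrη : 2 * (rate * r) ≤ η := by
    have : r ≤ η / (2 * rate) := by rw [hr]; exact min_le_right _ _
    rw [le_div_iff₀ (by positivity)] at this
    linarith
  -- In a window of length `κ / ε` at most `(rate + η) * κ / ε` atoms are within reach, each
  -- changing the velocity by at most `4 * vmax * ε`; the total is `b / 8`.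
  obtain ⟨κ, hκ⟩ : ∃ κ, κ = b / (32 * vmax * (rate + η)) := ⟨_, rfl⟩
  have hκ0 : 0 < κ := by rw [hκ]; positivity
  -- Collects the numbers of windows (at most `2 * T`), cells (at most `T * (4 * b / η + 5)`) and
  -- tail events per cell.
  obtain ⟨C₀, hC₀⟩ : ∃ C₀ : ℝ, C₀ = 2 * ((4 * b / η + 5) * (1 + 4 * K)) := ⟨_, rfl⟩
  have hC₀pos : 0 < C₀ := by rw [hC₀]; positivity
  obtain ⟨ε₁, hε₁, hsmall⟩ := Piston.exists_exp_le_rpow_log_log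
    ((nL + nR) * (4 * vmax) * Real.exp 1 + 1) (c := b / (8 * vmax)) (by positivity)
  obtain ⟨ε₂, hε₂, hlarge⟩ := Piston.exists_exp_le_rpow_log_log
    (Real.log C₀) (c := r * (η * κ) / 2) (by positivity)
  -- The last three bounds give `|V₀| ≤ b / 2`, windows of length at least `1`, and `N ≥ 2` for
  -- short times.
  refine ⟨min (min ε₁ ε₂) (min (b ^ 2 / 4) (min κ (b / (16 * vmax)))), by positivity, ?_⟩
  intro m M hm hM hε hslow V₀ hV₀ Ω _ μ _ S hS T hT
  have hR : Piston.SlowRegime m M b vmin := ⟨hm, hM, hb, hvmin, hslow⟩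
  have hkick := Piston.kick_le hm hM
  obtain ⟨ε, hεdef⟩ : ∃ ε, ε = m / M := ⟨_, rfl⟩
  rw [← hεdef] at hε hV₀ hkick ⊢
  have hε0 : 0 < ε := by rw [hεdef]; positivity
  simp only [lt_min_iff] at hε
  obtain ⟨⟨hεa, hεb⟩, hεc, hεd, hεe⟩ := hε
  have hV : |V₀| ≤ b / 2 := by
    refine hV₀.le.trans (Real.sqrt_le_iff.mpr ⟨by positivity, ?_⟩)
    rw [div_pow]
    linarith
  refine Piston.exists_measurableSet_of_measure_not_le (by positivity) ?_
  rcases le_total T 1 with hT1 | hT1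
  · have hx : (2 : ℝ) ≤ b / (8 * vmax) / ε := by
      rw [div_div, le_div_iff₀ (by positivity)]
      rw [lt_div_iff₀ (by positivity)] at hεe
      linarith
    have hfl := Nat.floor_le (by linarith : 0 ≤ b / (8 * vmax) / ε)
    have hfl' := Nat.lt_floor_add_one (b / (8 * vmax) / ε)
    refine (Piston.measure_not_coincide_le_sq hS hfL hfR hnL hnR hvmax hR hV hT hT1
      (N := ⌊b / (8 * vmax) / ε⌋₊) ?_ (Nat.le_floor (by exact_mod_cast hx))).trans
      (ENNReal.ofReal_le_ofReal ?_)
    · calc Piston.kick m M * (2 * vmax) * ⌊b / (8 * vmax) / ε⌋₊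
          ≤ 2 * ε * (2 * vmax) * (b / (8 * vmax) / ε) := by gcongr
        _ = b / 2 := by field_simp; ring
    · refine mul_le_mul_of_nonneg_left (le_trans ?_ (hsmall ε hε0 hεa)) (by positivity)
      rw [Real.exp_le_exp]
      linarith
  · have hτ1 : 1 ≤ κ / ε := by rw [le_div_iff₀ hε0]; linarith
    have hτ0 : 0 < κ / ε := by positivity
    have hn := Nat.le_ceil (T / (κ / ε))
    have hn' := Nat.ceil_lt_add_one (by positivity : 0 ≤ T / (κ / ε))
    set n := ⌈T / (κ / ε)⌉₊
    have hnT : (n : ℝ) ≤ 2 * T := by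
      have : T / (κ / ε) ≤ T := div_le_self hT.le hτ1
      linarith
    have hJ := Nat.le_ceil (b * n / η + 1)
    have hJ' := Nat.ceil_lt_add_one (by positivity : 0 ≤ b * n / η + 1)
    set J := ⌈b * n / η + 1⌉₊
    have hJT : 2 * (J : ℝ) + 1 ≤ T * (4 * b / η + 5) := by
      have : b * n / η ≤ b * (2 * T) / η := by gcongr
      have e : T * (4 * b / η + 5) = 2 * (b * (2 * T) / η) + 5 * T := by ring
      linarith
    refine (Piston.measure_not_coincide_le hS hfL hfR hnL hnR hvmax hbal hR hV hδ0 hKδ hη0 hτ0 h1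
      (h2.trans (mul_le_mul_of_nonneg_right (min_le_left _ _) hbv))
      (h2.trans (mul_le_mul_of_nonneg_right (min_le_right _ _) hbv)) hr0.le hr1 hrate hrη ?_
      (n := n) (J := J) ?_ hJ).trans (ENNReal.ofReal_le_ofReal ?_)
    · calc Piston.kick m M * (2 * vmax) * ((rate + η) * (κ / ε))
          ≤ 2 * ε * (2 * vmax) * ((rate + η) * (κ / ε)) := by gcongr
        _ = b / 8 := by rw [hκ]; field_simp; ring
    · rwa [div_le_iff₀ hτ0] at hn
    · have hexp := hlarge ε hε0 hεb
      calc (n : ℝ) * ((2 * J + 1) * ((1 + 4 * K) * Real.exp (-(r * (η * (κ / ε)) / 2))))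
          ≤ 2 * T * (T * (4 * b / η + 5) * ((1 + 4 * K)
              * Real.exp (-(r * (η * (κ / ε)) / 2)))) := by gcongr
        _ = T ^ 2 * Real.exp (Real.log C₀ - r * (η * κ) / 2 / ε) := by
            rw [sub_eq_add_neg, Real.exp_add, Real.exp_log hC₀pos, hC₀]
            have e : -(r * (η * (κ / ε)) / 2) = -(r * (η * κ) / 2 / ε) := by ring
            rw [e]
            ring
        _ ≤ _ := mul_le_mul_of_nonneg_left hexp (by positivity)
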